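/- Let $n,m\ge 0$ and let $\omega\in S_{n+1}$. \emph{Hecke words.} For $1\le i\le n$ let $\bar s_i$ act on arrangements of $1,\dots,n+1$ by interchanging the values $i$ and $i+1$ if $i$ lies to the left of $i+1$, and by doing nothing otherwise. A word $i_1\cdots i_k$ in the letters $1,\dots,n$ is a \emph{Hecke word} for $\omega$ if applying $\bar s_{i_k},\dots,\bar s_{i_1}$ in this order to $(1,2,\dots,n+1)$ gives $\omega$. \emph{Double Hecke factorizations.} Let $\mathcal F^{\square}_\omega$ be the set of (unbounded) double Hecke factorizations of $\omega$ into $2m+2$ factors: sequences of $2m+2$ (possibly empty) words whose concatenation is a Hecke word for $\omega$, where each of the first $m+1$ words is strictly increasing and each of the last $m+1$ words is strictly decreasing. For $1\le i\le m+1$, the $i$-th entry of the $x$-weight (respectively, of the $y$-weight) is the number of letters in the $i$-th factor to the right (respectively, left) of center, counted from the center. \emph{Tableaux.} $HT_\omega$ is the set of Hecke tableaux for $\omega$: fillings of a Young diagram by letters in $\{1,\dots,n\}$, strictly increasing along rows and down columns, such that reading the rows left to right, from the bottom row to the top row, gives a Hecke word for $\omega$. $PSVT$ is the set of primed set-valued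 tableaux: fillings of a Young diagram by nonempty subsets of the ordered alphabet $1'<2'<\cdots<(m+1)'<1<2<\cdots<m+1$ such that all entries of a box are $\le$ all entries of the box to its right and of the box below it, each unprimed $i$ appears in at most one box of each row, and each $i'$ appears in at most one box of each column. The $i$-th entry of the $x$-weight (respectively, $y$-weight) is the number of times $i$ (respectively, $i'$) appears. \emph{Hecke insertion.} A letter $a$ is inserted into the first row of an insertion tableau. When $a$ is inserted into a row $Y$, let $h$ be the column of the first entry of $Y$ exceeding $a$, or the first free column of $Y$ if there is no such entry; say that $a$ is \emph{placeable} if $a$ does not occur in $Y$ and either $Y$ is the first row or $a$ exceeds the entry in column $h$ of the row above $Y$. If no entry of $Y$ exceeds $a$, then $a$ is appended to $Y$ if it is placeable and disappears otherwise, and the insertion ends. If $y$ is the first entry of $Y$ exceeding $a$, then $y$ is replaced by $a$ if $a$ is placeable, $Y$ is left unchanged otherwise, and in both cases $y$ is inserted into the next row. The insertion is recorded by adding a label, in a second (recording) tableau of the same shape, to the newly created box if a letter was appended, and, if a letter disappeared in row $Y$, to the lowest box in the column of the rightmost box of $Y$. \emph{Semistandard Hecke insertion} of a sequence of factors inserts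 all their letters one after the other, from left to right, and labels the letters of the $i$-th factor by $i$. \emph{The map $\Phi$.} Given $\mathfrak f\in\mathcal F^{\square}_\omega$ with left half $\mathfrak f_\ell$ and right half $\mathfrak f_r$ (of $m+1$ factors each), reverse the order of the factors of $\mathfrak f_\ell$ and the order of the letters in each of them, and apply semistandard Hecke insertion to the result, starting from the empty tableaux. Transpose the insertion tableau and the recording tableau obtained, and prime all entries of the latter. Starting from this pair of tableaux, continue semistandard Hecke insertion with the factors of $\mathfrak f_r$, labelling the letters of the $i$-th factor of $\mathfrak f_r$ by the unprimed $i$. Let $\Phi(\mathfrak f)=(P,Q)$ be the final insertion and recording tableaux. \textbf{Proposition.} $\Phi$ is a bijection from $\mathcal F^{\square}_\omega$ to the set of pairs $(P,Q)$ of tableaux of the same shape with $P\in HT_\omega$ and $Q\in PSVT$, and it preserves the $x$-weight and the $y$-weight. -/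

import Mathlib

namespace DoubleHecke

/-! ### Hecke words

The letter `i : Fin n` stands for the operator which is usually written with index `i + 1` in
`{1, …, n}`.  Permutations of `{1, …, n + 1}` are elements of `Equiv.Perm (Fin (n + 1))`, and the
arrangement of `σ` is `(σ 0, σ 1, …, σ n)`, so that the value `v` stands at position `σ⁻¹ v`. -/

/-- The operator of index `i` on arrangements: interchange the values `i` and `i + 1` if `i` lies to
the left of `i + 1`, and do nothing otherwise. -/
def heckeAct {n : ℕ} (i : Fin n) (σ : Equiv.Perm (Fin (n + 1))) : Equiv.Perm (Fin (n + 1)) :=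
  if σ⁻¹ i.castSucc < σ⁻¹ i.succ then Equiv.swap i.castSucc i.succ * σ else σ

/-- The permutation represented by a word: its operators are applied, from right to left, to the
identity arrangement. -/
def heckeProduct {n : ℕ} (w : List (Fin n)) : Equiv.Perm (Fin (n + 1)) :=
  w.foldr heckeAct 1

/-- `w` is a Hecke word for `ω`. -/
def IsHeckeWord {n : ℕ} (ω : Equiv.Perm (Fin (n + 1))) (w : List (Fin n)) : Prop :=
  heckeProduct w = ω

/-! ### Double Hecke factorizations -/

/-- A sequence of `2 m + 2` words in the letters `Fin n`: `left 0, …, left m` are the factors to the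
left of center and `right 0, …, right m` those to the right of center, each half listed from left
to right. -/
@[ext]
structure DoubleFactorization (n m : ℕ) where
  left : Fin (m + 1) → List (Fin n)
  right : Fin (m + 1) → List (Fin n)

namespace DoubleFactorization

variable {n m : ℕ}

/-- The underlying word, with all parentheses erased. -/
def word (f : DoubleFactorization n m) : List (Fin n) :=
  (List.ofFn f.left).flatten ++ (List.ofFn f.right).flatten

/-- The (unbounded) double Hecke factorizations of `ω` into `2 m + 2` factors: the factors in the
left half are increasing, those in the right half are decreasing, and the underlying word is a Hecke
word for `ω`. -/
structure IsDoubleHecke (ω : Equiv.Perm (Fin (n + 1))) (f : DoubleFactorization n m) : Prop where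
  left_increasing : ∀ i, (f.left i).Pairwise (· < ·)
  right_decreasing : ∀ i, (f.right i).Pairwise (· > ·)
  isHeckeWord : IsHeckeWord ω f.word

/-- The number of letters in the `i`-th factor to the right of center (counted from the center). -/
def xWeight (f : DoubleFactorization n m) (i : Fin (m + 1)) : ℕ := (f.right i).length

/-- The number of letters in the `i`-th factor to the left of center (counted from the center). -/
def yWeight (f : DoubleFactorization n m) (i : Fin (m + 1)) : ℕ := (f.left i.rev).length

end DoubleFactorization

/-! ### Tableaux with one entry per box, as lists of rows from top to bottom -/

section Tableaux

variable {α : Type*}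

/-- The transpose of a tableau: row `j` of the result is column `j` of `T` from top to bottom. -/
def transposeRows (T : List (List α)) : List (List α) :=
  (List.range (T.headD []).length).map fun j => T.filterMap fun row => row[j]?

/-- The rows of `T` have the lengths prescribed by the Young diagram `μ`. -/
def HasShape (T : List (List α)) (μ : YoungDiagram) : Prop :=
  T.map List.length = μ.rowLens

/-- The word obtained by reading each row from left to right, the rows from bottom to top. -/
def readingWord (T : List (List α)) : List α := T.reverse.flatten

end Tableaux

/-- Hecke tableaux for `ω` of shape `μ`: rows and columns are strictly increasing and the reading
word is a Hecke word for `ω`. -/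
structure IsHeckeTableau {n : ℕ} (ω : Equiv.Perm (Fin (n + 1))) (μ : YoungDiagram)
    (P : List (List (Fin n))) : Prop where
  hasShape : HasShape P μ
  row_strict : ∀ row ∈ P, row.Pairwise (· < ·)
  col_strict : ∀ col ∈ transposeRows P, col.Pairwise (· < ·)
  isHeckeWord : IsHeckeWord ω (readingWord P)

/-! ### Primed set-valued tableaux

A set-valued filling is a function `Q` giving the set `Q i j` of entries of the box in row `i` and
column `j`; it is empty outside the shape. -/

/-- The ordered alphabet `1' < 2' < ⋯ < (m + 1)' < 1 < 2 < ⋯ < m + 1`; the primed letters are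
`Sum.inlₗ i`, the unprimed ones are `Sum.inrₗ i`. -/
abbrev PrimedLetter (m : ℕ) : Type := Fin (m + 1) ⊕ₗ Fin (m + 1)

/-- The letter `i'`. -/
def primed {m : ℕ} (i : Fin (m + 1)) : PrimedLetter m := Sum.inlₗ i

/-- The letter `i`, without a prime. -/
def unprimed {m : ℕ} (i : Fin (m + 1)) : PrimedLetter m := Sum.inrₗ i

/-- Primed set-valued tableaux of shape `μ`. -/
structure IsPrimedSetValued {m : ℕ} (μ : YoungDiagram) (Q : ℕ → ℕ → Finset (PrimedLetter m)) :
    Prop where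
  nonempty_iff : ∀ i j, (Q i j).Nonempty ↔ (i, j) ∈ μ
  row_le : ∀ i j, ∀ a ∈ Q i j, ∀ b ∈ Q i (j + 1), a ≤ b
  col_le : ∀ i j, ∀ a ∈ Q i j, ∀ b ∈ Q (i + 1) j, a ≤ b
  unprimed_row : ∀ k i j j', unprimed k ∈ Q i j → unprimed k ∈ Q i j' → j = j'
  primed_col : ∀ k i i' j, primed k ∈ Q i j → primed k ∈ Q i' j → i = i'

/-- The number of times that `k` appears in `Q`. -/
noncomputable def tableauXWeight {m : ℕ} (Q : ℕ → ℕ → Finset (PrimedLetter m))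
    (k : Fin (m + 1)) : ℕ :=
  {c : ℕ × ℕ | unprimed k ∈ Q c.1 c.2}.ncard

/-- The number of times that `k'` appears in `Q`. -/
noncomputable def tableauYWeight {m : ℕ} (Q : ℕ → ℕ → Finset (PrimedLetter m))
    (k : Fin (m + 1)) : ℕ :=
  {c : ℕ × ℕ | primed k ∈ Q c.1 c.2}.ncard

/-! ### Hecke insertion -/

section Insertion

variable {α : Type*} [LinearOrder α] {β : Type*} [DecidableEq β]

/-- What happens to a row when a letter is inserted into it: the letter is appended at the end, or
it disappears, or the row becomes `row` and the letter `out` goes on to the next row. -/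
inductive RowOutcome (α : Type*) where
  | appended (row : List α) : RowOutcome α
  | disappeared : RowOutcome α
  | bumped (row : List α) (out : α) : RowOutcome α

/-- Insert `a` into the row `Y`, where `X` is the row above (`X = []` if `Y` is the first row).

The letter `a` may be placed in column `h`, the column of the first entry of `Y` that exceeds `a`
(or the first free column if there is none), if `a` does not already occur in `Y` and `a` exceeds
the entry of `X` in column `h`.
* If no entry of `Y` exceeds `a`, then `a` is appended if it may be placed; else it disappears.
* If `y` is the first entry of `Y` that exceeds `a`, then `y` is the output; it is replaced by `a` if
  `a` may be placed, and otherwise `Y` is unchanged. -/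
def insertRow (X Y : List α) (a : α) : RowOutcome α :=
  let h := Y.findIdx fun y => a < y
  let placeable : Prop := (∀ y ∈ Y, a ≠ y) ∧ ∀ x ∈ X[h]?, x < a
  match Y[h]? with
  | none => if placeable then .appended (Y ++ [a]) else .disappeared
  | some y => if placeable then .bumped (Y.set h a) y else .bumped Y y

/-- Insert `a` into the tableau with rows `T`, placed below a row `X` (`X = []` if there is none),
starting in the first row of `T`.  The result is the new tableau together with the row and the column
of the box in which this insertion is recorded: the new box if the letter is finally appended, and, if
the letter disappears in a row `Y`, the lowest box in the column of the last box of `Y`. -/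
def insertBelow (X : List α) : List (List α) → α → List (List α) × ℕ × ℕ
  | [], a => ([[a]], 0, 0)
  | Y :: T, a =>
    match insertRow X Y a with
    | .appended Y' => (Y' :: T, 0, Y.length)
    | .disappeared => (Y :: T, T.countP (fun Z => Y.length ≤ Z.length), Y.length - 1)
    | .bumped Y' b =>
      let r := insertBelow Y' T b
      (Y' :: r.1, r.2.1 + 1, r.2.2)

/-- Add the entry `b` to the box in row `r` and column `c`. -/
def addEntry (Q : ℕ → ℕ → Finset β) (r c : ℕ) (b : β) : ℕ → ℕ → Finset β :=
  fun i j => if i = r ∧ j = c then insert b (Q i j) else Q i j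

/-- One step of Hecke insertion: insert the letter `a` into the insertion tableau and record it by
the entry `b` in the recording tableau. -/
def insertStep (b : β) (S : List (List α) × (ℕ → ℕ → Finset β)) (a : α) :
    List (List α) × (ℕ → ℕ → Finset β) :=
  let r := insertBelow [] S.1 a
  (r.1, addEntry S.2 r.2.1 r.2.2 b)

/-- Semistandard Hecke insertion of the factors `f 0, f 1, …`, starting from the pair `S`; the letters
of the factor `f i` are recorded by the entry `label i`. -/
def insertFactors {k : ℕ} (label : Fin k → β) (f : Fin k → List α)
    (S : List (List α) × (ℕ → ℕ → Finset β)) : List (List α) × (ℕ → ℕ → Finset β) :=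
  (List.finRange k).foldl (fun S i => (f i).foldl (insertStep (label i)) S) S

end Insertion

/-- The left half of `f` is reversed (the order of its factors and of the letters within each factor)
and inserted by semistandard Hecke insertion into the empty pair. -/
def leftInsertion {n m : ℕ} (f : DoubleFactorization n m) :
    List (List (Fin n)) × (ℕ → ℕ → Finset (Fin (m + 1))) :=
  insertFactors id (fun i => (f.left i.rev).reverse) ([], fun _ _ => ∅)

/-- Both tableaux of `leftInsertion f` are transposed and all entries of the recording tableau are
primed; then semistandard Hecke insertion goes on from this pair with the right half of `f`. -/
def doubleInsertion {n m : ℕ} (f : DoubleFactorization n m) :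
    List (List (Fin n)) × (ℕ → ℕ → Finset (PrimedLetter m)) :=
  insertFactors unprimed f.right
    (transposeRows (leftInsertion f).1, fun i j => ((leftInsertion f).2 j i).image primed)

end DoubleHecke

/-!
The proof follows the insertion of a single letter through the rows of a tableau. A letter `a`
that has been bumped out of column `p` of a row `X` is *admissible* for the rows below
(`Admissible`): replacing the entry of `X` in column `p` by `a` would still leave an increasing
tableau. For such letters a row step has only four outcomes (`RowStep`), and a letter that cannot
be placed either occurs in the row already or meets an equal letter right above it. Four
properties follow by induction on the rows.

* Hecke insertion preserves increasing tableaux and records the letter in a corner of the new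
  shape (`isIncreasing_insertBelow`, `rowLength_insertBelow`).
* It preserves the element represented by the reading word in every monoid with elements
  satisfying the `0`-Hecke relations (`wordProd_insertBelow`).
* Pieri property: after a letter `a`, a letter `b` is recorded in a strictly lower row if and only
  if `b < a` (`record_lt_record`, `record_le_record`).
* It is invertible: an increasing tableau, one of its corners, and the information whether this
  corner is a new box, determine a unique tableau and a unique letter (`insertBelow_injective`,
  `exists_insertBelow`).

A sequence of decreasing factors is a biword, that is, a list of labelled letters in which the
labels increase weakly and the letters with equal labels decrease. By the Pieri property, the box
of the last letter inserted is the lowest box that contains the greatest label, and equal labels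
lie in different rows, hence at most once in each row. Removing this box, or the label from it,
inverts the last step. Thus insertion of biwords, starting from pairs whose labels are smaller
than the new ones, is a bijection (`insertionSpec_insertPairs`, `insertPairs_injective`,
`exists_insertPairs`).

This is applied to both halves. For the left half there are no old labels and the insertion starts
from the empty pair; transposition turns the condition on the rows of the recording tableau into
the condition on the columns for primed letters. For the right half the primed letters are the old
labels. The Hecke product is preserved because the column word of an increasing tableau arises
from its row word by commutations (`wordProd_columns`), so that transposition reverses the
represented element (`wordProd_readingWord_transposeRows`); this compensates for the reversal of
the left half.
-/

namespace DoubleHecke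

/-! ### Row insertion -/

section Rows
variable {α : Type*} [LinearOrder α]

theorem sorted_lt {Y : List α} (hY : Y.Pairwise (· < ·)) {i j : ℕ} {a b : α}
    (ha : Y[i]? = some a) (hb : Y[j]? = some b) (hij : i < j) : a < b := by
  rw [List.pairwise_iff_getElem] at hY
  obtain ⟨hi, rfl⟩ := List.getElem?_eq_some_iff.1 ha
  obtain ⟨hj, rfl⟩ := List.getElem?_eq_some_iff.1 hb
  exact hY _ _ hi hj hij

theorem sorted_lt_iff {Y : List α} (hY : Y.Pairwise (· < ·)) {i j : ℕ} {a b : α}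
    (ha : Y[i]? = some a) (hb : Y[j]? = some b) : a < b ↔ i < j := by
  refine ⟨fun h => ?_, sorted_lt hY ha hb⟩
  by_contra hij
  rcases (not_lt.1 hij).lt_or_eq with h' | rfl
  · exact lt_asymm h (sorted_lt hY hb ha h')
  · exact h.ne (Option.some.inj (ha.symm.trans hb))

/-- The row `X` may stand directly above the row `Y`: it is at least as long and its entries are
smaller than those below them. -/
def Dominates (X Y : List α) : Prop :=
  ∀ (j : ℕ) (y : α), Y[j]? = some y → ∃ x, X[j]? = some x ∧ x < y

/-- Increasing tableaux, as lists of nonempty rows. -/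
def IsIncreasing : List (List α) → Prop
  | [] => True
  | Y :: T => Y ≠ [] ∧ Y.Pairwise (· < ·) ∧ (∀ Z ∈ T.head?, Dominates Y Z) ∧ IsIncreasing T

/-- The situation in which Hecke insertion arrives at the tableau `T` with the letter `a`: either
`T` starts with the first row (`X = []`), or `a` has just been bumped out of column `p` of the row
above, which has thereby become `X`.  If that row was left unchanged (`x = a`), then `p` is not the
first column: the letter inserted into the row either occurs there, to the left of `a`, or has
itself been bumped out of column `p` of an unchanged row. -/
def Admissible (X : List α) (T : List (List α)) (a : α) : Prop :=
  X.Pairwise (· < ·) ∧ (X = [] ∨ ∃ p x, X[p]? = some x ∧ x ≤ a ∧ (x = a → 0 < p) ∧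
    (∀ z, X[p + 1]? = some z → a < z) ∧
    ∀ Y ∈ T.head?, Dominates X Y ∧ ∀ y, Y[p]? = some y → a < y)

/-- The possible outcomes of inserting the letter `a` into the row `Y` below the row `X`.  A letter
that cannot be placed either occurs in `Y` or would stand right below an equal entry of `X`; a
greater entry of `X` is impossible for admissible letters. -/
inductive RowStep (X Y : List α) (a : α) : RowOutcome α → Prop
  | append (hY : ∀ y ∈ Y, y < a) (hX : ∀ x, X[Y.length]? = some x → x < a) :
      RowStep X Y a (.appended (Y ++ [a]))
  | vanish (hY : ∀ y ∈ Y, y ≤ a) (hX : a ∈ Y ∨ X[Y.length]? = some a ∧ a ∉ Y) :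
      RowStep X Y a .disappeared
  | replace (h : ℕ) (y : α) (hy : Y[h]? = some y) (hay : a < y)
      (hY : ∀ j z, j < h → Y[j]? = some z → z < a) (hX : ∀ x, X[h]? = some x → x < a) :
      RowStep X Y a (.bumped (Y.set h a) y)
  | keep (h : ℕ) (y : α) (hy : Y[h]? = some y) (hay : a < y)
      (hY : ∀ j z, j < h → Y[j]? = some z → z ≤ a) (hX : a ∈ Y ∨ X[h]? = some a ∧ a ∉ Y) :
      RowStep X Y a (.bumped Y y)

theorem RowStep.eq {X Y : List α} {a : α} {o : RowOutcome α} (hY : Y.Pairwise (· < ·))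
    (h : RowStep X Y a o) : insertRow X Y a = o := by
  cases h with
  | append h1 h2 =>
    have : Y.findIdx (fun y => a < y) = Y.length := by
      rw [List.findIdx_eq_length]; intro y hy; simpa using (h1 y hy).le
    simp only [insertRow, this]
    grind
  | vanish h1 h2 =>
    have : Y.findIdx (fun y => a < y) = Y.length := by
      rw [List.findIdx_eq_length]; intro y hy; simpa using (h1 y hy)
    simp only [insertRow, this]
    grind
  | replace h y hy hay h1 h2 =>
    obtain ⟨hh, rfl⟩ := List.getElem?_eq_some_iff.1 hy
    have : Y.findIdx (fun y => a < y) = h := by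
      rw [List.findIdx_eq hh]
      refine ⟨by simpa using hay, fun j hj => ?_⟩
      simpa using (h1 j _ hj (List.getElem?_eq_getElem _)).le
    have h3 : ∀ z ∈ Y, a ≠ z := by
      intro z hz
      obtain ⟨j, hj⟩ := List.mem_iff_getElem?.1 hz
      rcases lt_or_ge j h with h' | h'
      · exact (h1 j z h' hj).ne'
      · rintro rfl
        have := (sorted_lt_iff hY hj hy).1 hay
        grind [sorted_lt_iff]
    simp only [insertRow, this]
    grind
  | keep h y hy hay h1 h2 =>
    obtain ⟨hh, rfl⟩ := List.getElem?_eq_some_iff.1 hy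
    have : Y.findIdx (fun y => a < y) = h := by
      rw [List.findIdx_eq hh]
      refine ⟨by simpa using hay, fun j hj => ?_⟩
      simpa using (h1 j _ hj (List.getElem?_eq_getElem _))
    have h3 : ¬ ((∀ y ∈ Y, a ≠ y) ∧ ∀ x ∈ X[h]?, x < a) := by
      rintro ⟨h3, h4⟩
      rcases h2 with h2 | h2
      · exact h3 a h2 rfl
      · exact lt_irrefl a (h4 a h2.1)
    simp only [insertRow, this, hy, if_neg h3]

/-- The column in which `a` arrives is weakly to the left of the column from which it was bumped,
so the entry above it does not exceed `a`. -/
theorem Admissible.eq_of_le {X Y : List α} {T : List (List α)} {a : α}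
    (hX : Admissible X (Y :: T) a) {h : ℕ} {x : α}
    (hh : ∀ (j : ℕ) y, Y[j]? = some y → j < h → y ≤ a) (hl : h ≤ Y.length)
    (hx : X[h]? = some x) (hax : a ≤ x) : x = a := by
  obtain ⟨hs, rfl | ⟨p, x', hp, hle, -, h1, h2⟩⟩ := hX
  · simp at hx
  have h3 := (h2 Y (by simp)).2
  have : h ≤ p := by
    by_contra hc
    push Not at hc
    have hpl : p < Y.length := by omega
    have := h3 _ (List.getElem?_eq_getElem hpl)
    exact absurd (hh p _ (List.getElem?_eq_getElem hpl) hc) (not_le.2 this)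
  rcases this.lt_or_eq with h' | rfl
  · exact absurd (sorted_lt hs hx hp h') (not_lt.2 (hle.trans hax))
  · exact le_antisymm (by grind) hax

theorem rowStep_insertRow {X Y : List α} {T : List (List α)} {a : α} (hY : Y.Pairwise (· < ·))
    (hX : Admissible X (Y :: T) a) : RowStep X Y a (insertRow X Y a) := by
  set h := Y.findIdx (fun y => a < y) with hh
  have hl : h ≤ Y.length := List.findIdx_le_length
  have hlt : ∀ j y, Y[j]? = some y → j < h → y ≤ a := by
    intro j y hy hj
    obtain ⟨hj', rfl⟩ := List.getElem?_eq_some_iff.1 hy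
    simpa using List.not_of_lt_findIdx hj
  have hge : ∀ y, Y[h]? = some y → a < y := by
    intro y hy
    obtain ⟨hj', rfl⟩ := List.getElem?_eq_some_iff.1 hy
    simpa using List.findIdx_getElem (w := hj')
  have key : ∀ x, X[h]? = some x → a ≤ x → x = a := fun x => hX.eq_of_le hlt hl
  by_cases hlen : h = Y.length
  · have hle : ∀ y ∈ Y, y ≤ a := by
      intro z hz
      obtain ⟨j, hj⟩ := List.mem_iff_getElem?.1 hz
      exact hlt j z hj (by grind)
    by_cases hp : (∀ y ∈ Y, a ≠ y) ∧ ∀ x ∈ X[h]?, x < a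
    · have := RowStep.append (X := X) (Y := Y) (a := a)
        (fun y hy => lt_of_le_of_ne (hle y hy) (hp.1 y hy).symm) (by grind)
      exact this.eq hY ▸ this
    · have := RowStep.vanish (X := X) (Y := Y) (a := a) hle (by grind)
      exact this.eq hY ▸ this
  · obtain ⟨y, hy⟩ : ∃ y, Y[h]? = some y := ⟨_, List.getElem?_eq_getElem (by omega)⟩
    by_cases hp : (∀ y ∈ Y, a ≠ y) ∧ ∀ x ∈ X[h]?, x < a
    · have := RowStep.replace (X := X) (Y := Y) (a := a) h y hy (hge y hy)
        (fun j z hj hz => lt_of_le_of_ne (hlt j z hz hj)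
          (hp.1 z (List.mem_iff_getElem?.2 ⟨j, hz⟩)).symm) (by grind)
      exact this.eq hY ▸ this
    · have := RowStep.keep (X := X) (Y := Y) (a := a) h y hy (hge y hy)
        (fun j z hj hz => hlt j z hz hj) (by grind)
      exact this.eq hY ▸ this

end Rows

/-! ### Shapes and validity of the insertion -/

section RowLength
variable {α : Type*}

/-- The length of row `i` of a tableau, which is `0` if there is no such row. -/
def rowLength (T : List (List α)) (i : ℕ) : ℕ := (T[i]?.getD []).length

@[simp] theorem rowLength_nil (i : ℕ) : rowLength ([] : List (List α)) i = 0 := by simp [rowLength]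

@[simp] theorem rowLength_cons_zero (Y : List α) (T : List (List α)) :
    rowLength (Y :: T) 0 = Y.length := by simp [rowLength]

@[simp] theorem rowLength_cons_succ (Y : List α) (T : List (List α)) (i : ℕ) :
    rowLength (Y :: T) (i + 1) = rowLength T i := by simp [rowLength]

end RowLength

section Validity
variable {α : Type*} [LinearOrder α]

theorem sorted_set {Y : List α} {h : ℕ} {a : α} (hY : Y.Pairwise (· < ·))
    (h1 : ∀ (j : ℕ) z, j < h → Y[j]? = some z → z < a)
    (h2 : ∀ (j : ℕ) z, h < j → Y[j]? = some z → a < z) : (Y.set h a).Pairwise (· < ·) := by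
  rw [List.pairwise_iff_getElem] at hY ⊢
  intro i j hi hj hij
  rw [List.length_set] at hi hj
  have hi' := List.getElem?_eq_getElem hi
  have hj' := List.getElem?_eq_getElem hj
  rw [List.getElem_set, List.getElem_set]
  split_ifs with h3 h4 h4
  · omega
  · exact h2 j _ (h3 ▸ hij) hj'
  · exact h1 i _ (h4 ▸ hij) hi'
  · exact hY i j hi hj hij

theorem Dominates.length_le {X Y : List α} (h : Dominates X Y) : Y.length ≤ X.length := by
  by_contra hc
  obtain ⟨x, hx, -⟩ := h X.length _ (List.getElem?_eq_getElem (by omega))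
  simp at hx

theorem Admissible.head_lt {X : List α} {T : List (List α)} {a x : α} (hX : Admissible X T a)
    (hx : X[0]? = some x) : x < a := by
  obtain ⟨hs, rfl | ⟨p, x', hp, hle, h0, -⟩⟩ := hX
  · simp at hx
  rcases p.eq_zero_or_pos with rfl | hp0
  · obtain rfl : x = x' := Option.some.inj (hx.symm.trans hp)
    exact lt_of_le_of_ne hle fun h => lt_irrefl 0 (h0 h)
  · exact (sorted_lt hs hx hp hp0).trans_le hle

theorem Admissible.dominates {X Y : List α} {T : List (List α)} {a : α}
    (hX : Admissible X (Y :: T) a) (hne : X ≠ []) : Dominates X Y := by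
  obtain ⟨hs, h | ⟨p, x', hp, hle, h0, -, h1⟩⟩ := hX
  · exact absurd h hne
  · exact (h1 Y (by simp)).1

/-- A bumped letter that still occurs in the row above was bumped out of the column in which it
stands, and this is not the first column. -/
theorem Admissible.pos_of_eq {X : List α} {T : List (List α)} {a : α} (hX : Admissible X T a)
    {h : ℕ} (hx : X[h]? = some a) : 0 < h := by
  obtain ⟨hs, rfl | ⟨p, x', hp, hle, h0, h1, -⟩⟩ := hX
  · simp at hx
  have h2 : ¬ p + 1 ≤ h := by
    intro hc
    rcases hc.lt_or_eq with hc | rfl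
    · have hl : p + 1 < X.length := by
        have := (List.getElem?_eq_some_iff.1 hx).1
        omega
      have h3 := List.getElem?_eq_getElem hl
      exact lt_asymm (h1 _ h3) (sorted_lt hs h3 hx hc)
    · exact lt_irrefl a (h1 _ hx)
  have h3 : ¬ h < p := fun hc => not_lt.2 hle (sorted_lt hs hx hp hc)
  obtain rfl : h = p := by omega
  exact h0 (Option.some.inj (hp.symm.trans hx))

/-- A bumping step keeps the rows increasing, and the bumped letter is admissible in the rows
below. -/
theorem RowStep.bumped_spec {X Y Y' : List α} {T : List (List α)} {a y : α}
    (hT : IsIncreasing (Y :: T)) (hX : Admissible X (Y :: T) a)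
    (hs : RowStep X Y a (.bumped Y' y)) :
    Y'.Pairwise (· < ·) ∧ Y'.length = Y.length ∧ (X ≠ [] → Dominates X Y') ∧
      Admissible Y' T y := by
  obtain ⟨-, hY, hD, -⟩ := hT
  cases hs with
  | replace h y hy hay h1 h2 =>
    have hsort : (Y.set h a).Pairwise (· < ·) := by
      refine sorted_set hY h1 fun j z hj hz => hay.trans (sorted_lt hY hy hz hj)
    have hl : h < Y.length := (List.getElem?_eq_some_iff.1 hy).1
    have hget : (Y.set h a)[h]? = some a := by simp [hl]
    refine ⟨hsort, by simp, fun hne j z hz => ?_, hsort, .inr ⟨h, a, hget, hay.le, ?_, ?_, ?_⟩⟩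
    · have hXY := hX.dominates hne
      by_cases hj : h = j
      · subst hj
        obtain ⟨x, hx, -⟩ := hXY h y hy
        exact ⟨x, hx, by grind⟩
      · exact hXY j z (by grind)
    · exact fun h' => absurd h' hay.ne
    · intro z hz
      exact sorted_lt hY hy (by grind : Y[h + 1]? = some z) (by omega)
    · intro Z hZ
      have hYZ := hD Z hZ
      refine ⟨fun j z hz => ?_, fun z hz => ?_⟩
      · obtain ⟨x, hx, hxz⟩ := hYZ j z hz
        by_cases hj : h = j
        · subst hj
          exact ⟨a, hget, by grind⟩
        · exact ⟨x, by grind, hxz⟩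
      · obtain ⟨x, hx, hxz⟩ := hYZ h z hz
        grind
  | keep h y hy hay h1 h2 =>
    refine ⟨hY, rfl, hX.dominates, hY, .inr ⟨h, y, hy, le_rfl, fun _ => ?_, ?_, ?_⟩⟩
    · rcases h2 with h2 | h2
      · obtain ⟨j, hj⟩ := List.mem_iff_getElem?.1 h2
        have := (sorted_lt_iff hY hj hy).1 hay
        omega
      · exact hX.pos_of_eq h2.1
    · exact fun z hz => sorted_lt hY hy hz (by omega)
    · intro Z hZ
      refine ⟨hD Z hZ, fun z hz => ?_⟩
      obtain ⟨x, hx, hxz⟩ := hD Z hZ h z hz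
      grind

theorem Dominates.append {X Y : List α} {T : List (List α)} {a : α} (hX : Admissible X (Y :: T) a)
    (hne : X ≠ []) (hY : ∀ y ∈ Y, y < a) (hx : ∀ x, X[Y.length]? = some x → x < a) :
    Dominates X (Y ++ [a]) := by
  intro j z hz
  have hXY := hX.dominates hne
  obtain ⟨hs, h | ⟨p, x', hp, hle, h0, -, h1⟩⟩ := hX
  · exact absurd h hne
  have hp1 : Y.length ≤ p := by
    by_contra hc
    push Not at hc
    exact lt_asymm (hY _ (List.getElem_mem hc)) ((h1 Y (by simp)).2 _ (List.getElem?_eq_getElem hc))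
  have hp2 := (List.getElem?_eq_some_iff.1 hp).1
  by_cases hj : j < Y.length
  · exact hXY j z (by grind)
  · obtain rfl : j = Y.length := by grind
    obtain rfl : z = a := by grind
    have := List.getElem?_eq_getElem (show Y.length < X.length by omega)
    exact ⟨_, this, hx _ this⟩

theorem dominates_append {Y Z : List α} (h : Dominates Y Z) (l : List α) :
    Dominates (Y ++ l) Z := by
  intro j z hz
  obtain ⟨y, hy, hyz⟩ := h j z hz
  exact ⟨y, by grind, hyz⟩

/-- Hecke insertion preserves increasing tableaux. -/
theorem isIncreasing_insertBelow {T : List (List α)} : ∀ {X : List α} {a : α}, IsIncreasing T →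
    Admissible X T a → IsIncreasing (insertBelow X T a).1 ∧
      (X ≠ [] → ∀ Z ∈ (insertBelow X T a).1.head?, Dominates X Z) := by
  induction T with
  | nil =>
    intro X a _ hX
    refine ⟨by simp [insertBelow, IsIncreasing], fun hne Z hZ j z hz => ?_⟩
    simp only [insertBelow, List.head?_cons, Option.mem_some_iff] at hZ
    subst hZ
    obtain ⟨rfl, rfl⟩ : j = 0 ∧ z = a := by grind
    have := List.getElem?_eq_getElem (List.length_pos_iff.2 hne)
    exact ⟨_, this, hX.head_lt this⟩
  | cons Y T ih =>
    intro X a hT hX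
    have hT' := hT
    obtain ⟨hne, hY, hD, hT⟩ := hT
    have hstep := rowStep_insertRow hY hX
    rw [insertBelow]
    generalize insertRow X Y a = o at hstep
    match o, hstep with
    | .appended _, .append h1 h2 =>
      refine ⟨⟨by simp, ?_, fun Z hZ => dominates_append (hD Z hZ) _, hT⟩, ?_⟩
      · rw [List.pairwise_append]
        exact ⟨hY, by simp, by simpa using h1⟩
      · simpa using fun hne => Dominates.append hX hne h1 h2
    | .disappeared, _ => exact ⟨hT', by simpa using hX.dominates⟩
    | .bumped Y' y, hstep =>
      obtain ⟨h1, h2, h3, h4⟩ := hstep.bumped_spec hT' hX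
      have hne' : Y' ≠ [] := by
        rw [← List.length_pos_iff, h2]
        exact List.length_pos_iff.2 hne
      obtain ⟨h5, h6⟩ := ih hT h4
      exact ⟨⟨hne', h1, h6 hne', h5⟩, by simpa using h3⟩

theorem IsIncreasing.rowLength_le {Y : List α} {T : List (List α)} (h : IsIncreasing (Y :: T)) :
    ∀ i, rowLength T i ≤ Y.length := by
  induction T generalizing Y with
  | nil => simp
  | cons Z T ih =>
    obtain ⟨-, -, hD, hT⟩ := h
    have := (hD Z (by simp)).length_le
    rintro (_ | i)
    · simpa
    · simpa using (ih hT i).trans this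

theorem lt_countP_iff {T : List (List α)} (h : IsIncreasing T) {k : ℕ} (hk : 0 < k) (i : ℕ) :
    i < T.countP (fun Z => k ≤ Z.length) ↔ k ≤ rowLength T i := by
  induction T generalizing i with
  | nil => simp; omega
  | cons Y T ih =>
    have ih := ih h.2.2.2
    have hle := h.rowLength_le
    by_cases hY : k ≤ Y.length
    · rw [List.countP_cons_of_pos (by simpa using hY)]
      cases i with
      | zero => simpa using hY
      | succ i => simpa using ih i
    · rw [List.countP_cons_of_neg (by simpa using hY)]
      have h0 : T.countP (fun Z => k ≤ Z.length) = 0 := by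
        by_contra hc
        have := (ih 0).1 (Nat.pos_of_ne_zero hc)
        exact hY (this.trans (hle 0))
      rw [h0]
      cases i with
      | zero => simpa using hY
      | succ i => simpa using (hle i).trans_lt (not_le.1 hY)

theorem IsIncreasing.rowLength_anti {T : List (List α)} (h : IsIncreasing T) {i j : ℕ}
    (hij : i ≤ j) : rowLength T j ≤ rowLength T i := by
  by_contra hc
  have h1 := (lt_countP_iff h (k := rowLength T j) (by omega) j).2 le_rfl
  have h2 := (lt_countP_iff h (k := rowLength T j) (by omega) i).not.2 hc
  omega

/-- Hecke insertion changes the length of at most one row, by adding one box to it; it is recorded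
in a corner of the resulting shape, which is the new box if there is one. -/
theorem rowLength_insertBelow {T : List (List α)} : ∀ {X : List α} {a : α}, IsIncreasing T →
    Admissible X T a → ∀ {T' : List (List α)} {r c : ℕ}, insertBelow X T a = (T', r, c) →
      (∀ i, i ≠ r → rowLength T' i = rowLength T i) ∧ rowLength T' r = c + 1 ∧
        rowLength T' (r + 1) ≤ c ∧ (rowLength T r = c ∨ rowLength T r = c + 1) := by
  induction T with
  | nil =>
    intro X a _ hX T' r c h
    simp only [insertBelow, Prod.mk.injEq] at h
    obtain ⟨rfl, rfl, rfl⟩ := h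
    refine ⟨?_, by simp, by simp, by simp⟩
    rintro (_ | i) hi
    · omega
    · simp
  | cons Y T ih =>
    intro X a hT hX T' r c h
    have hT' := hT
    obtain ⟨hne, hY, hD, hT⟩ := hT
    have hstep := rowStep_insertRow hY hX
    rw [insertBelow] at h
    generalize insertRow X Y a = o at hstep h
    match o, hstep with
    | .appended _, .append h1 h2 =>
      simp only [Prod.mk.injEq] at h
      obtain ⟨rfl, rfl, rfl⟩ := h
      refine ⟨?_, by simp, by simpa using hT'.rowLength_le 0, by simp⟩
      rintro (_ | i) hi
      · omega
      · simp
    | .disappeared, _ =>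
      simp only [Prod.mk.injEq] at h
      obtain ⟨rfl, rfl, rfl⟩ := h
      have hpos := List.length_pos_iff.2 hne
      set r := T.countP (fun Z => Y.length ≤ Z.length) with hr
      have hlen : rowLength (Y :: T) r = Y.length := by
        rcases hr' : r with _ | s
        · simp
        · have := (lt_countP_iff hT hpos s).1 (by omega)
          simpa using le_antisymm (hT'.rowLength_le s) this
      have hlen' : rowLength T r < Y.length := by
        have := (lt_countP_iff hT hpos r).not.1 (by omega)
        omega
      refine ⟨fun _ _ => rfl, by omega, ?_, by omega⟩
      simp
      omega
    | .bumped Y' y, hstep =>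
      obtain ⟨h1, h2, h3, h4⟩ := hstep.bumped_spec hT' hX
      obtain ⟨g1, g2, g3, g4⟩ := ih hT h4 rfl
      simp only [Prod.mk.injEq] at h
      obtain ⟨rfl, rfl, rfl⟩ := h
      refine ⟨?_, by simpa using g2, by simpa using g3, by simpa using g4⟩
      rintro (_ | i) hi
      · simpa using h2
      · simpa using g1 i fun h => hi (congrArg (· + 1) h)

end Validity

/-! ### Reading words in the `0`-Hecke monoid -/

section Words
variable {α : Type*} {M : Type*} [Monoid M]

/-- The product of the elements `g a` along a word. -/
def wordProd (g : α → M) (w : List α) : M := (w.map g).prod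

@[simp] theorem wordProd_nil (g : α → M) : wordProd g [] = 1 := rfl

@[simp] theorem wordProd_cons (g : α → M) (a : α) (w : List α) :
    wordProd g (a :: w) = g a * wordProd g w := by simp [wordProd]

@[simp] theorem wordProd_append (g : α → M) (v w : List α) :
    wordProd g (v ++ w) = wordProd g v * wordProd g w := by simp [wordProd]

theorem commute_wordProd {g : α → M} {w : List α} {x : M} (h : ∀ a ∈ w, Commute (g a) x) :
    Commute (wordProd g w) x :=
  Commute.list_prod_left _ _ (by simpa using h)

theorem exists_split {Y : List α} {h : ℕ} {y : α} (hy : Y[h]? = some y) :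
    ∃ L R, Y = L ++ y :: R ∧ L.length = h := by
  obtain ⟨hh, rfl⟩ := List.getElem?_eq_some_iff.1 hy
  exact ⟨Y.take h, Y.drop (h + 1), by simp, by simp; omega⟩

theorem readingWord_cons (Y : List α) (T : List (List α)) :
    readingWord (Y :: T) = readingWord T ++ Y := by simp [readingWord]

variable [LinearOrder α]

/-- Elements `g a` of a monoid that satisfy the relations of the `0`-Hecke monoid.  For `α = Fin n`,
letters with another letter strictly between them are those whose indices differ by at least two;
the braid relation follows from the other two relations for such letters. -/
structure IsHeckeFamily (g : α → M) : Prop where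
  idem : ∀ a, g a * g a = g a
  braid : ∀ a b, g a * g b * g a = g b * g a * g b
  comm : ∀ a b c, a < b → b < c → Commute (g a) (g c)

/-- A letter is absorbed from the left by a word in which it is preceded only by letters that
commute with it. -/
theorem IsHeckeFamily.absorb {g : α → M} (hg : IsHeckeFamily g) {L R : List α} {a : α}
    (hL : ∀ l ∈ L, Commute (g l) (g a)) :
    g a * wordProd g (L ++ a :: R) = wordProd g (L ++ a :: R) := by
  have h := commute_wordProd hL
  simp only [wordProd_append, wordProd_cons]
  rw [← mul_assoc, ← mul_assoc, ← h.eq, mul_assoc _ (g a) (g a), hg.idem, mul_assoc]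

/-- If `a` cannot be placed into `Y` because of the equal entry of the row above, then `X` absorbs
the letter `a`. -/
theorem IsHeckeFamily.absorb_above {g : α → M} (hg : IsHeckeFamily g) {X Y : List α}
    {T : List (List α)} {a : α} (hX : Admissible X (Y :: T) a) {h : ℕ} (hx : X[h]? = some a)
    (hh : h ≤ Y.length) (hY : ∀ (j : ℕ) z, j < h → Y[j]? = some z → z ≤ a) (ha : a ∉ Y) :
    g a * wordProd g X = wordProd g X := by
  have hne : X ≠ [] := by rintro rfl; simp at hx
  have hD := hX.dominates hne
  obtain ⟨L, R, rfl, rfl⟩ := exists_split hx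
  refine hg.absorb fun l hl => ?_
  obtain ⟨j, hj⟩ := List.mem_iff_getElem?.1 hl
  have hjL : j < L.length := (List.getElem?_eq_some_iff.1 hj).1
  have hz := List.getElem?_eq_getElem (show j < Y.length by omega)
  obtain ⟨x, hx', hxz⟩ := hD j _ hz
  obtain rfl : x = l := by grind
  exact hg.comm _ _ _ hxz (lt_of_le_of_ne (hY j _ hjL hz) (by grind))

theorem sorted_split {L R : List α} {y : α} (h : (L ++ y :: R).Pairwise (· < ·)) :
    (∀ l ∈ L, l < y) ∧ ∀ r ∈ R, y < r := by
  rw [List.pairwise_append] at h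
  refine ⟨fun l hl => h.2.2 l hl y (by simp), fun r hr => ?_⟩
  exact (List.pairwise_cons.1 h.2.1).1 r hr

/-- A sorted word whose greatest letter is `a` ends in `a`. -/
theorem sorted_eq_append {L : List α} {a : α} (hs : L.Pairwise (· < ·)) (ha : a ∈ L)
    (hL : ∀ l ∈ L, l ≤ a) : ∃ L', L = L' ++ [a] := by
  obtain ⟨L', R, rfl⟩ := List.append_of_mem ha
  have h1 := (sorted_split hs).2
  match R with
  | [] => exact ⟨L', rfl⟩
  | r :: R => exact absurd (hL r (by simp)) (not_le.2 (h1 r (by simp)))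

/-- Bumping `y` out of `Y` by `a` amounts to moving `y` to the front of the row.  The row above is
needed as a factor because it may have to absorb `a`. -/
theorem RowStep.wordProd_bumped {g : α → M} (hg : IsHeckeFamily g) {X Y Y' : List α}
    {T : List (List α)} {a y : α} (hY : Y.Pairwise (· < ·)) (hX : Admissible X (Y :: T) a)
    (hs : RowStep X Y a (.bumped Y' y)) :
    wordProd g Y * g a * wordProd g X = g y * wordProd g Y' * wordProd g X := by
  cases hs with
  | replace h y hy hay h1 h2 =>
    obtain ⟨L, R, rfl, rfl⟩ := exists_split hy
    have hL : Commute (wordProd g L) (g y) := commute_wordProd fun l hl => by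
      obtain ⟨j, hj⟩ := List.mem_iff_getElem?.1 hl
      exact hg.comm _ _ _ (h1 j l (by grind) (by grind)) hay
    have hR : Commute (wordProd g R) (g a) := commute_wordProd fun r hr =>
      (hg.comm _ _ _ hay ((sorted_split hY).2 r hr)).symm
    have hset : (L ++ y :: R).set L.length a = L ++ a :: R := by simp
    congr 1
    rw [hset]
    simp only [wordProd_append, wordProd_cons]
    calc _ = wordProd g L * g y * (wordProd g R * g a) := by simp only [mul_assoc]
      _ = _ := by rw [hR.eq, hL.eq]; simp only [mul_assoc]
  | keep h y hy hay h1 h2 =>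
    rcases h2 with h2 | ⟨h2, h3⟩
    · obtain ⟨L, R, rfl, rfl⟩ := exists_split hy
      obtain ⟨L, rfl⟩ : ∃ L', L = L' ++ [a] := by
        refine sorted_eq_append (List.pairwise_append.1 hY).1 ?_ fun l hl => ?_
        · have := (sorted_split hY).2
          rcases List.mem_append.1 h2 with h2 | h2
          · exact h2
          · rcases List.mem_cons.1 h2 with rfl | h2
            · exact absurd hay (lt_irrefl _)
            · exact absurd (this a h2) (lt_asymm hay)
        · obtain ⟨j, hj⟩ := List.mem_iff_getElem?.1 hl
          exact h1 j l (by grind) (by grind)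
      have hL : Commute (wordProd g L) (g y) := commute_wordProd fun l hl =>
        hg.comm _ _ _ ((sorted_split (List.pairwise_append.1 hY).1).1 l hl) hay
      have hR : Commute (wordProd g R) (g a) := commute_wordProd fun r hr =>
        (hg.comm _ _ _ hay ((sorted_split hY).2 r hr)).symm
      congr 1
      simp only [wordProd_append, wordProd_cons, wordProd_nil, mul_one]
      calc _ = wordProd g L * (g a * g y * (wordProd g R * g a)) := by simp only [mul_assoc]
        _ = wordProd g L * (g a * g y * g a) * wordProd g R := by rw [hR.eq]; simp only [mul_assoc]
        _ = (wordProd g L * g y) * g a * g y * wordProd g R := by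
          rw [hg.braid]; simp only [mul_assoc]
        _ = _ := by rw [hL.eq]; simp only [mul_assoc]
    · have hh := (List.getElem?_eq_some_iff.1 hy).1
      rw [mul_assoc, hg.absorb_above hX h2 hh.le h1 h3]
      obtain ⟨L, R, rfl, rfl⟩ := exists_split hy
      rw [hg.absorb]
      intro l hl
      obtain ⟨j, hj⟩ := List.mem_iff_getElem?.1 hl
      have := h1 j l (by grind) (by grind)
      exact hg.comm _ a _ (lt_of_le_of_ne this (by grind)) hay

/-- Hecke insertion preserves the element of a `0`-Hecke monoid that is represented by the reading
word.  In a lower row this holds up to multiplication by the row above. -/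
theorem wordProd_insertBelow {g : α → M} (hg : IsHeckeFamily g) {T : List (List α)} :
    ∀ {X : List α} {a : α}, IsIncreasing T → Admissible X T a →
      wordProd g (readingWord T) * g a * wordProd g X =
        wordProd g (readingWord (insertBelow X T a).1) * wordProd g X := by
  induction T with
  | nil => intro X a _ _; simp [insertBelow, readingWord]
  | cons Y T ih =>
    intro X a hT hX
    have hT' := hT
    obtain ⟨hne, hY, hD, hT⟩ := hT
    have hstep := rowStep_insertRow hY hX
    rw [insertBelow]
    generalize insertRow X Y a = o at hstep
    match o, hstep with
    | .appended _, .append h1 h2 => simp [readingWord_cons, mul_assoc]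
    | .disappeared, .vanish h1 h2 =>
      simp only [readingWord_cons, wordProd_append, mul_assoc]
      congr 1
      rcases h2 with h2 | ⟨h2, h3⟩
      · obtain ⟨L, rfl⟩ := sorted_eq_append hY h2 h1
        rw [← mul_assoc]
        simp [mul_assoc, hg.idem]
      · rw [hg.absorb_above hX h2 le_rfl
          (fun j z _ hz => h1 z (List.mem_iff_getElem?.2 ⟨j, hz⟩)) h3]
    | .bumped Y' y, hstep =>
      obtain ⟨g1, g2, g3, g4⟩ := hstep.bumped_spec hT' hX
      simp only [readingWord_cons, wordProd_append]
      rw [← ih hT g4, mul_assoc, mul_assoc, ← mul_assoc _ (g a), hstep.wordProd_bumped hg hY hX]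
      simp only [mul_assoc]

end Words

/-! ### The Pieri property -/

section Pieri
variable {α : Type*} [LinearOrder α]

theorem RowStep.bumped_column {X Y Y' : List α} {a y : α} (hs : RowStep X Y a (.bumped Y' y)) :
    ∃ h, Y[h]? = some y ∧ a < y ∧ (∀ (j : ℕ) z, j < h → Y[j]? = some z → z ≤ a) ∧
      (Y' = Y.set h a ∧ (∀ x, X[h]? = some x → x < a) ∧
          (∀ (j : ℕ) z, j < h → Y[j]? = some z → z < a) ∨
        Y' = Y ∧ (a ∈ Y ∨ X[h]? = some a ∧ a ∉ Y)) := by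
  cases hs with
  | replace h y hy hay h1 h2 =>
    exact ⟨h, hy, hay, fun j z hj hz => (h1 j z hj hz).le, .inl ⟨rfl, h2, h1⟩⟩
  | keep h y hy hay h1 h2 => exact ⟨h, hy, hay, h1, .inr ⟨rfl, h2⟩⟩

/-- The columns in which letters are bumped move weakly to the left, so an insertion that bumps in
column `p` or to the left of it passes all rows that reach column `p`. -/
theorem countP_le_record {T : List (List α)} {p : ℕ} : ∀ {X : List α} {a : α}, IsIncreasing T →
    Admissible X T a → (∀ Y ∈ T.head?, ∀ y, Y[p]? = some y → a < y) →
      T.countP (fun Z => p + 1 ≤ Z.length) ≤ (insertBelow X T a).2.1 := by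
  induction T with
  | nil => simp
  | cons Y T ih =>
    intro X a hT hX hp
    by_cases hl : p + 1 ≤ Y.length
    · have hT' := hT
      obtain ⟨hne, hY, hD, hT⟩ := hT
      have hy0 := List.getElem?_eq_getElem (show p < Y.length by omega)
      have hay0 := hp Y (by simp) _ hy0
      have hstep := rowStep_insertRow hY hX
      rw [insertBelow]
      generalize insertRow X Y a = o at hstep
      match o, hstep with
      | .appended _, .append h1 h2 =>
        exact absurd (h1 _ (List.mem_of_getElem? hy0)) (lt_asymm hay0)
      | .disappeared, .vanish h1 h2 =>
        exact absurd (h1 _ (List.mem_of_getElem? hy0)) (not_le.2 hay0)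
      | .bumped Y' y, hstep =>
        obtain ⟨g1, g2, g3, g4⟩ := hstep.bumped_spec hT' hX
        obtain ⟨h, hy, hay, h1, -⟩ := hstep.bumped_column
        have hhp : h ≤ p := by
          by_contra hc
          exact absurd (h1 p _ (by omega) hy0) (not_le.2 hay0)
        rw [List.countP_cons_of_pos (by simpa using hl)]
        have := ih hT g4 fun Z hZ z hz => by
          obtain ⟨x, hx, hxz⟩ := hD Z hZ p z hz
          refine lt_of_le_of_lt ?_ hxz
          by_contra hc
          have := (sorted_lt_iff hY hx hy).1 (not_le.1 hc)
          omega
        simpa using this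
    · have := (lt_countP_iff hT (Nat.succ_pos p) 0).not.2 (by simpa using hl)
      exact (not_lt.1 this).trans (Nat.zero_le _)

/-- Pieri property, strict case: after `a`, a smaller letter `b` is recorded in a lower row. -/
theorem record_lt_record {T : List (List α)} : ∀ {X X' : List α} {a b : α}, IsIncreasing T →
    Admissible X T a → Admissible X' (insertBelow X T a).1 b → (X = [] ∨ b ∈ X) → b < a →
      (insertBelow X T a).2.1 < (insertBelow X' (insertBelow X T a).1 b).2.1 := by
  induction T with
  | nil =>
    intro X X' a b _ hX hX' hb hba
    simp only [insertBelow] at hX' ⊢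
    have hstep := rowStep_insertRow (by simp) hX'
    generalize insertRow X' [a] b = o at hstep
    match o, hstep with
    | .appended _, .append h1 h2 => exact absurd (h1 a (by simp)) (lt_asymm hba)
    | .disappeared, .vanish h1 h2 => exact absurd (h1 a (by simp)) (not_le.2 hba)
    | .bumped Y' y, hstep => simp
  | cons Y T ih =>
    intro X X' a b hT hX hX' hb hba
    have hT₁ := (isIncreasing_insertBelow hT hX).1
    have hT' := hT
    obtain ⟨hne, hY, hD, hT⟩ := hT
    have hstep := rowStep_insertRow hY hX
    rw [insertBelow] at hX' hT₁ ⊢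
    -- A letter that is kept in its row because of an equal entry of `X` lies to the right of `b`.
    have hcol : ∀ h : ℕ, X[h]? = some a → ∃ q : ℕ, q < h ∧ ∀ y, Y[q]? = some y → b < y := by
      intro h hx
      have hne : X ≠ [] := by rintro rfl; simp at hx
      obtain ⟨q, hq⟩ := List.mem_iff_getElem?.1 (hb.resolve_left hne)
      refine ⟨q, (sorted_lt_iff hX.1 hq hx).1 hba, fun y hy => ?_⟩
      obtain ⟨x, hx, hxy⟩ := hX.dominates hne q y hy
      grind
    generalize insertRow X Y a = o at hstep hX' hT₁
    match o, hstep with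
    | .appended _, .append h1 h2 =>
      have hstep' := rowStep_insertRow hT₁.2.1 hX'
      simp only [insertBelow]
      generalize insertRow X' (Y ++ [a]) b = o at hstep'
      match o, hstep' with
      | .appended _, .append h1 h2 => exact absurd (h1 a (by simp)) (lt_asymm hba)
      | .disappeared, .vanish h1 h2 => exact absurd (h1 a (by simp)) (not_le.2 hba)
      | .bumped Y' y, hstep => simp
    | .disappeared, .vanish h1 h2 =>
      have hpos := List.length_pos_iff.2 hne
      have hlast : ∃ y ∈ Y, b < y := by
        rcases h2 with h2 | ⟨h2, -⟩
        · exact ⟨a, h2, hba⟩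
        · obtain ⟨q, hq, hq'⟩ := hcol _ h2
          have := List.getElem?_eq_getElem hq
          exact ⟨_, List.mem_of_getElem? this, hq' _ this⟩
      have hmax := List.getElem?_eq_getElem (show Y.length - 1 < Y.length by omega)
      have hmax' : b < Y[Y.length - 1] := by
        obtain ⟨y, hy, hby⟩ := hlast
        obtain ⟨j, hj⟩ := List.mem_iff_getElem?.1 hy
        refine hby.trans_le ?_
        by_contra hc
        have := (sorted_lt_iff hY hmax hj).1 (not_le.1 hc)
        grind
      have := countP_le_record (p := Y.length - 1) hT' hX' (by grind)
      rw [show Y.length - 1 + 1 = Y.length by omega] at this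
      rw [List.countP_cons_of_pos (by simp)] at this
      exact this
    | .bumped Y' a', hstep =>
      obtain ⟨g1, g2, g3, g4⟩ := hstep.bumped_spec hT' hX
      obtain ⟨h, hy, hay, h1, h2⟩ := hstep.bumped_column
      have hh := (List.getElem?_eq_some_iff.1 hy).1
      have hstep' := rowStep_insertRow g1 hX'
      -- An entry of `Y'` that is smaller than `a'` and exceeds `b`.
      have hlast : ∃ (q : ℕ) (z : α), Y'[q]? = some z ∧ b < z ∧ z < a' := by
        rcases h2 with ⟨rfl, h2, h3⟩ | ⟨rfl, h2 | ⟨h2, -⟩⟩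
        · exact ⟨h, a, by simp [hh], hba, hay⟩
        · obtain ⟨j, hj⟩ := List.mem_iff_getElem?.1 h2
          exact ⟨j, a, hj, hba, hay⟩
        · obtain ⟨q, hq, hq'⟩ := hcol _ h2
          have := List.getElem?_eq_getElem (hq.trans hh)
          exact ⟨q, _, this, hq' _ this, sorted_lt hY this hy hq⟩
      obtain ⟨q, z, hz, hbz, hza⟩ := hlast
      have hz' := List.mem_of_getElem? hz
      simp only [insertBelow]
      have hne' : Y' ≠ [] := by rintro rfl; simp at hz
      generalize insertRow X' Y' b = o at hstep'
      match o, hstep' with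
      | .appended _, .append h1 h2 => exact absurd (h1 z hz') (lt_asymm hbz)
      | .disappeared, .vanish h1 h2 => exact absurd (h1 z hz') (not_le.2 hbz)
      | .bumped Y'' b', hstep' =>
        obtain ⟨f1, f2, f3, f4⟩ := hstep'.bumped_spec hT₁ hX'
        obtain ⟨k, hy', hby', k1, k2⟩ := hstep'.bumped_column
        have hlt : b' < a' := by
          refine lt_of_le_of_lt ?_ hza
          by_contra hc
          have := (sorted_lt_iff g1 hz hy').1 (not_le.1 hc)
          exact absurd (k1 q z this hz) (not_le.2 hbz)
        have := ih hT g4 f4 (.inr (List.mem_of_getElem? hy')) hlt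
        simpa using this

/-- Pieri property, weak case: after `a`, a letter `b ≥ a` is not recorded in a lower row. -/
theorem record_le_record {T : List (List α)} : ∀ {X X' : List α} {a b : α}, IsIncreasing T →
    Admissible X T a → Admissible X' (insertBelow X T a).1 b → a ≤ b →
      (insertBelow X' (insertBelow X T a).1 b).2.1 ≤ (insertBelow X T a).2.1 := by
  induction T with
  | nil =>
    intro X X' a b _ hX hX' hab
    simp only [insertBelow] at hX' ⊢
    have hstep := rowStep_insertRow (by simp) hX'
    generalize insertRow X' [a] b = o at hstep
    match o, hstep with
    | .appended _, .append h1 h2 => simp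
    | .disappeared, .vanish h1 h2 => simp
    | .bumped Y' y, hstep =>
      obtain ⟨h, hy, hby, -⟩ := hstep.bumped_column
      have := List.mem_of_getElem? hy
      grind
  | cons Y T ih =>
    intro X X' a b hT hX hX' hab
    have hT₁ := (isIncreasing_insertBelow hT hX).1
    have hT' := hT
    obtain ⟨hne, hY, hD, hT⟩ := hT
    have hstep := rowStep_insertRow hY hX
    have hpos := List.length_pos_iff.2 hne
    rw [insertBelow] at hX' hT₁ ⊢
    generalize insertRow X Y a = o at hstep hX' hT₁
    match o, hstep with
    | .appended _, .append h1 h2 =>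
      have hstep' := rowStep_insertRow hT₁.2.1 hX'
      simp only [insertBelow]
      generalize insertRow X' (Y ++ [a]) b = o at hstep'
      match o, hstep' with
      | .appended _, .append h1 h2 => simp
      | .disappeared, .vanish h1 h2 =>
        have := (lt_countP_iff hT (k := (Y ++ [a]).length) (by simp) 0).not.2
          (by simpa using (hT'.rowLength_le 0))
        simpa using this
      | .bumped Y' y, hstep =>
        obtain ⟨h, hy, hby, -⟩ := hstep.bumped_column
        rcases List.mem_append.1 (List.mem_of_getElem? hy) with hm | hm
        · exact absurd ((h1 y hm).trans_le hab) (lt_asymm hby)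
        · rw [List.mem_singleton.1 hm] at hby
          exact absurd hab (not_le.2 hby)
    | .disappeared, .vanish h1 h2 =>
      have hstep' := rowStep_insertRow hY hX'
      simp only [insertBelow]
      generalize insertRow X' Y b = o at hstep'
      match o, hstep' with
      | .appended _, .append h1 h2 => simp
      | .disappeared, .vanish _ _ => simp
      | .bumped Y' y, hstep =>
        obtain ⟨h, hy, hby, -⟩ := hstep.bumped_column
        exact absurd ((h1 y (List.mem_of_getElem? hy)).trans hab) (not_le.2 hby)
    | .bumped Y' a', hstep =>
      obtain ⟨g1, g2, g3, g4⟩ := hstep.bumped_spec hT' hX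
      obtain ⟨h, hy, hay, h1, h2⟩ := hstep.bumped_column
      have hh := (List.getElem?_eq_some_iff.1 hy).1
      have hstep' := rowStep_insertRow g1 hX'
      simp only [insertBelow]
      generalize insertRow X' Y' b = o at hstep'
      match o, hstep' with
      | .appended _, .append _ _ => simp
      | .disappeared, .vanish _ _ =>
        -- The bottom of the last column of `Y'` lies in a row that the first insertion has passed.
        obtain ⟨e1, e2, e3, e4⟩ := rowLength_insertBelow hT g4 rfl
        have hle := countP_le_record (p := Y'.length - 1) hT g4 (by
          intro Z hZ z hz
          obtain ⟨x, hx, hxz⟩ := hD Z hZ _ z hz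
          refine lt_of_le_of_lt ?_ hxz
          by_contra hc
          have := (sorted_lt_iff hY hx hy).1 (not_le.1 hc)
          omega)
        rw [show Y'.length - 1 + 1 = Y'.length by omega] at hle
        have hT₂ := hT₁.2.2.2
        by_contra hc
        have hc' := (lt_countP_iff hT₂ (k := Y'.length) (by omega) _).1 (not_le.1 hc)
        rw [e1 _ (by simp)] at hc'
        have := (lt_countP_iff hT (k := Y'.length) (by omega) _).2 hc'
        exact absurd (this.trans_le hle) (by simp)
      | .bumped Y'' b', hstep' =>
        obtain ⟨f1, f2, f3, f4⟩ := hstep'.bumped_spec hT₁ hX'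
        obtain ⟨k, hy', hby', k1, k2⟩ := hstep'.bumped_column
        have hle : a' ≤ b' := by
          by_contra hc
          push Not at hc
          rcases h2 with ⟨rfl, h2, h3⟩ | ⟨rfl, h2⟩
          · by_cases hkh : h = k
            · subst hkh
              grind
            · have := (sorted_lt_iff hY (by grind : Y[k]? = some b') hy).1 hc
              exact absurd (h1 k b' this (by grind)) (not_le.2 (hab.trans_lt hby'))
          · have := (sorted_lt_iff hY hy' hy).1 hc
            exact absurd (h1 k b' this hy') (not_le.2 (hab.trans_lt hby'))
        have := ih hT g4 f4 hle
        simpa using this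

end Pieri

/-! ### Invertibility of the insertion of one letter -/

section Inverse
variable {α : Type*} [LinearOrder α]

/-- The row above and the row `Y` determine a letter that bumps in column `h` of `Y` (or disappears
there) without changing `Y`. -/
theorem Admissible.eq_of_not_placeable {X Y : List α} {T T' : List (List α)} {a b : α} {h : ℕ}
    (ha : Admissible X (Y :: T) a) (hb : Admissible X (Y :: T') b) (hh : h ≤ Y.length)
    (ha1 : ∀ (j : ℕ) z, j < h → Y[j]? = some z → z ≤ a)
    (ha2 : ∀ (j : ℕ) z, h ≤ j → Y[j]? = some z → a < z)
    (hb1 : ∀ (j : ℕ) z, j < h → Y[j]? = some z → z ≤ b)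
    (hb2 : ∀ (j : ℕ) z, h ≤ j → Y[j]? = some z → b < z)
    (ha3 : a ∈ Y ∨ X[h]? = some a ∧ a ∉ Y) (hb3 : b ∈ Y ∨ X[h]? = some b ∧ b ∉ Y) : a = b := by
  have mixed : ∀ {T T' : List (List α)} {a b : α}, Admissible X (Y :: T) a →
      (∀ (j : ℕ) z, j < h → Y[j]? = some z → z ≤ a) →
      (∀ (j : ℕ) z, h ≤ j → Y[j]? = some z → a < z) →
      (∀ (j : ℕ) z, j < h → Y[j]? = some z → z ≤ b) →
      a ∈ Y → X[h]? = some b → b ∉ Y → False := by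
    intro T T' a b ha ha1 ha2 hb1 hm hx hn
    obtain ⟨hs, rfl | ⟨p, x, hp, hxa, -, -, h3⟩⟩ := ha
    · simp at hx
    have h3 := (h3 Y (by simp)).2
    have hhp : h ≤ p := by
      by_contra hc
      push Not at hc
      have := List.getElem?_eq_getElem (hc.trans_le hh)
      exact absurd (h3 _ this) (not_lt.2 (ha1 p _ hc this))
    have hba : b ≤ a := by
      refine le_trans ?_ hxa
      by_contra hc
      have := (sorted_lt_iff hs hp hx).1 (not_le.1 hc)
      omega
    obtain ⟨j, hj⟩ := List.mem_iff_getElem?.1 hm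
    have hjh : j < h := by
      by_contra hc
      exact lt_irrefl a (ha2 j a (not_lt.1 hc) hj)
    exact hn (le_antisymm hba (hb1 j a hjh hj) ▸ hm)
  rcases ha3 with ha3 | ⟨ha3, ha4⟩ <;> rcases hb3 with hb3 | ⟨hb3, hb4⟩
  · obtain ⟨i, hi⟩ := List.mem_iff_getElem?.1 ha3
    obtain ⟨j, hj⟩ := List.mem_iff_getElem?.1 hb3
    have hih : i < h := by
      by_contra hc
      exact lt_irrefl a (ha2 i a (not_lt.1 hc) hi)
    have hjh : j < h := by
      by_contra hc
      exact lt_irrefl b (hb2 j b (not_lt.1 hc) hj)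
    exact le_antisymm (hb1 i a hih hi) (ha1 j b hjh hj)
  · exact (mixed (T' := T') ha ha1 ha2 hb1 ha3 hb3 hb4).elim
  · exact (mixed (T' := T) hb hb1 hb2 ha1 hb3 ha3 ha4).elim
  · exact Option.some.inj (ha3.symm.trans hb3)

/-- A letter that bumps in the row `Y` is not recorded at the bottom of the last column of `Y`
unless it creates a new box there. -/
theorem RowStep.record_ne {X Y Y' : List α} {T T₂ : List (List α)} {a y : α}
    (hT : IsIncreasing (Y :: T)) (hX : Admissible X (Y :: T) a)
    (hs : RowStep X Y a (.bumped Y' y)) (hT₂ : IsIncreasing T₂)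
    (hl : ∀ i, rowLength T i = rowLength T₂ i) :
    (insertBelow Y' T y).2.1 + 1 ≠ T₂.countP (fun Z => Y.length ≤ Z.length) := by
  intro heq
  obtain ⟨g1, g2, g3, g4⟩ := hs.bumped_spec hT hX
  obtain ⟨h, hy, hay, h1, h2⟩ := hs.bumped_column
  obtain ⟨hne, hY, hD, hT⟩ := hT
  have hpos := List.length_pos_iff.2 hne
  have hle := countP_le_record (p := Y.length - 1) hT g4 (by
    intro Z hZ z hz
    obtain ⟨x, hx, hxz⟩ := hD Z hZ _ z hz
    refine lt_of_le_of_lt ?_ hxz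
    by_contra hc
    have := (sorted_lt_iff hY hx hy).1 (not_le.1 hc)
    have := (List.getElem?_eq_some_iff.1 hy).1
    omega)
  rw [show Y.length - 1 + 1 = Y.length by omega] at hle
  have h3 := (lt_countP_iff hT₂ hpos (insertBelow Y' T y).2.1).1
    (heq ▸ Nat.lt_succ_self _)
  rw [← hl] at h3
  exact absurd ((lt_countP_iff hT hpos _).2 h3) (not_lt.2 hle)

/-- The resulting row `Y'` and the bumped letter `y` determine the column `h` of the bump, and hence
the original row. -/
theorem RowStep.bumped_result {X Y Y' : List α} {a y : α} (hY : Y.Pairwise (· < ·))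
    (hs : RowStep X Y a (.bumped Y' y)) : ∃ h y', Y[h]? = some y ∧ Y'[h]? = some y' ∧ y' ≤ y ∧
      (∀ (j : ℕ) z, h < j → Y'[j]? = some z → y < z) ∧ Y'.set h y = Y ∧
      (∀ (j : ℕ) z, j < h → Y[j]? = some z → z ≤ a) ∧
      (∀ (j : ℕ) z, h ≤ j → Y[j]? = some z → a < z) ∧
      (y' < y ∧ y' = a ∨ y' = y ∧ Y' = Y ∧ (a ∈ Y ∨ X[h]? = some a ∧ a ∉ Y)) := by
  obtain ⟨h, hy, hay, h1, h2⟩ := hs.bumped_column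
  obtain ⟨hh, hyy⟩ := List.getElem?_eq_some_iff.1 hy
  have h3 : ∀ (j : ℕ) z, h < j → Y[j]? = some z → y < z := fun j z hj hz => sorted_lt hY hy hz hj
  have h4 : ∀ (j : ℕ) z, h ≤ j → Y[j]? = some z → a < z := by
    intro j z hj hz
    rcases hj.eq_or_lt with rfl | hj
    · grind
    · exact hay.trans (h3 j z hj hz)
  rcases h2 with ⟨rfl, h2, -⟩ | ⟨rfl, h2⟩
  · refine ⟨h, a, hy, by simp [hh], hay.le, fun j z hj hz => h3 j z hj (by grind), ?_, h1, h4,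
      .inl ⟨hay, rfl⟩⟩
    rw [List.set_set, ← hyy, List.set_getElem_self]
  · refine ⟨h, y, hy, hy, le_rfl, h3, ?_, h1, h4, .inr ⟨rfl, rfl, h2⟩⟩
    conv_lhs => rw [← hyy]
    exact List.set_getElem_self _

/-- Hecke insertion is injective: the resulting tableau, the box in which the insertion is recorded,
and the original shape determine the original tableau and the inserted letter. -/
theorem insertBelow_injective {T₁ : List (List α)} : ∀ {X : List α} {T₂ : List (List α)}
    {a₁ a₂ : α}, IsIncreasing T₁ → IsIncreasing T₂ → Admissible X T₁ a₁ → Admissible X T₂ a₂ →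
      (∀ i, rowLength T₁ i = rowLength T₂ i) → insertBelow X T₁ a₁ = insertBelow X T₂ a₂ →
        T₁ = T₂ ∧ a₁ = a₂ := by
  induction T₁ with
  | nil =>
    intro X T₂ a₁ a₂ _ hT₂ _ _ hl he
    match T₂ with
    | [] => simpa [insertBelow] using he
    | Y :: T => exact absurd (hl 0).symm (by simpa using hT₂.1)
  | cons Y T ih =>
    intro X T₂ a b hT hT₂ ha hb hl he
    match T₂ with
    | [] => exact absurd (hl 0) (by simpa using hT.1)
    | Y₂ :: T₂ =>
      have hlen : Y.length = Y₂.length := by simpa using hl 0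
      have hl' : ∀ i, rowLength T i = rowLength T₂ i := fun i => by simpa using hl (i + 1)
      have hs := rowStep_insertRow hT.2.1 ha
      have hs₂ := rowStep_insertRow hT₂.2.1 hb
      rw [insertBelow, insertBelow] at he
      generalize insertRow X Y a = o at hs he
      generalize insertRow X Y₂ b = o₂ at hs₂ he
      match o, hs, o₂, hs₂ with
      | .appended _, .append _ _, .appended _, .append _ _ => simp_all
      | .appended _, .append _ _, .disappeared, .vanish _ _ =>
        have := congrArg (fun R => rowLength R.1 0) he
        simp at this
        omega
      | .appended _, .append _ _, .bumped _ _, _ => simp at he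
      | .disappeared, .vanish _ _, .appended _, .append _ _ =>
        have := congrArg (fun R => rowLength R.1 0) he
        simp at this
        omega
      | .disappeared, .vanish h1 h2, .disappeared, .vanish k1 k2 =>
        simp only [Prod.mk.injEq, List.cons.injEq] at he
        obtain ⟨⟨rfl, rfl⟩, -⟩ := he
        refine ⟨rfl, ha.eq_of_not_placeable hb le_rfl ?_ ?_ ?_ ?_ h2 k2⟩
        · exact fun j z _ hz => h1 z (List.mem_of_getElem? hz)
        · exact fun j z hj hz => absurd (List.getElem?_eq_some_iff.1 hz).1 (not_lt.2 hj)
        · exact fun j z _ hz => k1 z (List.mem_of_getElem? hz)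
        · exact fun j z hj hz => absurd (List.getElem?_eq_some_iff.1 hz).1 (not_lt.2 hj)
      | .disappeared, .vanish h1 h2, .bumped Y' y, hs₂ =>
        refine absurd ?_ (hs₂.record_ne hT₂ hb hT.2.2.2 fun i => (hl' i).symm)
        simp only [Prod.mk.injEq] at he
        rw [← he.2.1, hlen]
      | .bumped _ _, _, .appended _, .append _ _ => simp at he
      | .bumped Y' y, hs, .disappeared, .vanish h1 h2 =>
        refine absurd ?_ (hs.record_ne hT ha hT₂.2.2.2 hl')
        simp only [Prod.mk.injEq] at he
        rw [he.2.1, hlen]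
      | .bumped Y' y, hs, .bumped Y₂' y₂, hs₂ =>
        simp only [Prod.mk.injEq, List.cons.injEq] at he
        obtain ⟨⟨rfl, e1⟩, e2, e3⟩ := he
        obtain ⟨g1, g2, g3, g4⟩ := hs.bumped_spec hT ha
        obtain ⟨k1, k2, k3, k4⟩ := hs₂.bumped_spec hT₂ hb
        obtain ⟨rfl, rfl⟩ := ih hT.2.2.2 hT₂.2.2.2 g4 k4 hl'
          (Prod.ext e1 (Prod.ext (by simpa using e2) e3))
        obtain ⟨h, y', p1, p2, p3, p4, p5, p6, p7, p8⟩ := hs.bumped_result hT.2.1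
        obtain ⟨k, y'', q1, q2, q3, q4, q5, q6, q7, q8⟩ := hs₂.bumped_result hT₂.2.1
        obtain rfl : h = k := by
          rcases lt_trichotomy h k with hc | hc | hc
          · exact absurd (p4 k _ hc q2) (not_lt.2 q3)
          · exact hc
          · exact absurd (q4 h _ hc p2) (not_lt.2 p3)
        obtain rfl : y' = y'' := Option.some.inj (p2.symm.trans q2)
        obtain rfl : Y = Y₂ := p5.symm.trans q5
        refine ⟨rfl, ?_⟩
        rcases p8 with ⟨p8, p9⟩ | ⟨p8, -, p9⟩ <;> rcases q8 with ⟨q8, q9⟩ | ⟨q8, -, q9⟩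
        · exact p9.symm.trans q9
        · exact absurd q8 p8.ne
        · exact absurd p8 q8.ne
        · exact ha.eq_of_not_placeable hb (List.getElem?_eq_some_iff.1 p1).1.le p6 p7 q6 q7 p9 q9

/-- For admissibility the column from which `a` was bumped need not be known exactly: it suffices
that the entries of the next row exceed `a` from some column `k` on. -/
theorem admissible_of_le {X : List α} {T : List (List α)} {a x : α} {k : ℕ}
    (hX : X.Pairwise (· < ·)) (hk : X[k]? = some x) (hx : x ≤ a) (h0 : x = a → 0 < k)
    (hT : ∀ Y ∈ T.head?, Dominates X Y ∧ ∀ (j : ℕ) y, k ≤ j → Y[j]? = some y → a < y) :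
    Admissible X T a := by
  classical
  -- The column from which `a` was bumped is the last one whose entry does not exceed `a`.
  set P : ℕ → Prop := fun p => ∃ x, X[p]? = some x ∧ x ≤ a with hP
  set p := Nat.findGreatest P X.length with hp
  have hkl := (List.getElem?_eq_some_iff.1 hk).1
  have hkp : k ≤ p := Nat.le_findGreatest hkl.le ⟨x, hk, hx⟩
  obtain ⟨x', hx', hxa⟩ : P p := Nat.findGreatest_spec hkl.le ⟨x, hk, hx⟩
  refine ⟨hX, .inr ⟨p, x', hx', hxa, fun he => ?_, fun z hz => ?_, fun Y hY => ?_⟩⟩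
  · rcases hkp.eq_or_lt with hkp | hkp
    · rw [← hkp] at hx' ⊢
      exact h0 ((Option.some.inj (hk.symm.trans hx')).trans he)
    · omega
  · by_contra hc
    have := (List.getElem?_eq_some_iff.1 hz).1
    have : p + 1 ≤ p := Nat.le_findGreatest this.le ⟨z, hz, not_lt.1 hc⟩
    omega
  · exact ⟨(hT Y hY).1, fun y hy => (hT Y hY).2 p y hkp hy⟩

/-- Inversion of the last step of an insertion that creates the box of `l` at the end of the row
`Y ++ [l]`. -/
theorem exists_insertBelow_append {X Y : List α} {T : List (List α)} {l : α}
    (hT : IsIncreasing ((Y ++ [l]) :: T)) (hX : X.Pairwise (· < ·))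
    (hD : X ≠ [] → Dominates X (Y ++ [l])) (hl : rowLength T 0 ≤ Y.length) :
    ∃ T₀ a, IsIncreasing T₀ ∧ Admissible X T₀ a ∧
      insertBelow X T₀ a = ((Y ++ [l]) :: T, 0, Y.length) ∧ rowLength T₀ 0 = Y.length := by
  obtain ⟨-, hY, hDT, hT⟩ := hT
  have hY' := List.pairwise_append.1 hY
  have hadm : ∀ T₀ : List (List α), (∀ Z ∈ T₀.head?, Z = Y) → Admissible X T₀ l := by
    intro T₀ hT₀
    by_cases hne : X = []
    · exact ⟨hX, .inl hne⟩
    obtain ⟨x, hx, hxl⟩ := hD hne Y.length l (by simp)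
    refine admissible_of_le hX hx hxl.le (fun h => absurd h hxl.ne) fun Z hZ => ?_
    obtain rfl := hT₀ Z hZ
    refine ⟨fun j z hz => hD hne j z (by grind), fun j y hj hy => ?_⟩
    exact absurd (List.getElem?_eq_some_iff.1 hy).1 (not_lt.2 hj)
  by_cases hYe : Y = []
  · subst hYe
    have : T = [] := by
      match T with
      | [] => rfl
      | Z :: T => exact absurd hl (by simpa using hT.1)
    subst this
    exact ⟨[], l, trivial, hadm _ (by simp), by simp [insertBelow], by simp⟩
  · have hadm := hadm (Y :: T) (by simp)
    have hs : RowStep X Y l (.appended (Y ++ [l])) := by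
      refine .append (fun y hy => hY'.2.2 y hy l (by simp)) fun x hx => ?_
      have hne : X ≠ [] := by rintro rfl; simp at hx
      obtain ⟨x', hx', hxl⟩ := hD hne Y.length l (by simp)
      grind
    refine ⟨Y :: T, l, ⟨hYe, hY'.1, fun Z hZ j z hz => ?_, hT⟩, hadm, ?_, by simp⟩
    · obtain ⟨x, hx, hxz⟩ := hDT Z hZ j z hz
      refine ⟨x, ?_, hxz⟩
      have : Z.length ≤ Y.length := by
        match T, hZ with
        | Z' :: T, hZ =>
          obtain rfl : Z' = Z := by simpa using hZ
          simpa using hl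
      have := (List.getElem?_eq_some_iff.1 hz).1
      grind
    · rw [insertBelow, hs.eq hY'.1]

/-- Inversion of the last step of an insertion in which the letter disappears in the row `Y`. -/
theorem exists_insertBelow_vanish {X Y : List α} {T : List (List α)}
    (hT : IsIncreasing (Y :: T)) (hX : X.Pairwise (· < ·))
    (hD : X ≠ [] → Dominates X Y) (hl : X = [] ∨ Y.length < X.length) :
    ∃ a, Admissible X (Y :: T) a ∧
      insertBelow X (Y :: T) a =
        (Y :: T, T.countP (fun Z => Y.length ≤ Z.length), Y.length - 1) := by
  obtain ⟨hne, hY, hDT, -⟩ := hT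
  have hpos := List.length_pos_iff.2 hne
  have hlast := List.getElem?_eq_getElem (show Y.length - 1 < Y.length by omega)
  set l := Y[Y.length - 1] with hl_def
  have hle : ∀ y ∈ Y, y ≤ l := by
    intro y hy
    obtain ⟨j, hj⟩ := List.mem_iff_getElem?.1 hy
    by_contra hc
    have := (sorted_lt_iff hY hlast hj).1 (not_le.1 hc)
    have := (List.getElem?_eq_some_iff.1 hj).1
    omega
  have fin : ∀ a, (∀ y ∈ Y, y ≤ a) → (a ∈ Y ∨ X[Y.length]? = some a) →
      insertBelow X (Y :: T) a =
        (Y :: T, T.countP (fun Z => Y.length ≤ Z.length), Y.length - 1) := by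
    intro a ha1 ha2
    have hs : RowStep X Y a .disappeared := .vanish ha1 (by tauto)
    rw [insertBelow, hs.eq hY]
  rcases hl with hl | hl
  · exact ⟨l, ⟨hX, .inl hl⟩, fin l hle (.inl (List.mem_of_getElem? hlast))⟩
  · have hx := List.getElem?_eq_getElem hl
    refine ⟨max l X[Y.length], admissible_of_le hX hx (le_max_right _ _) (fun _ => hpos) ?_,
      fin _ (fun y hy => (hle y hy).trans (le_max_left _ _)) ?_⟩
    · intro Z hZ
      obtain rfl : Y = Z := by simpa using hZ
      refine ⟨hD (by rintro rfl; simp at hl), fun j y hj hy => ?_⟩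
      exact absurd (List.getElem?_eq_some_iff.1 hy).1 (not_lt.2 hj)
    · rcases max_choice l X[Y.length] with h | h <;> rw [h]
      · exact .inl (List.mem_of_getElem? hlast)
      · exact .inr hx

/-- Inversion of a bumping step: if `y` may have been bumped out of the row that has become `Y'`,
then `Y'` and `y` arise from some row `Y` by the insertion of some letter. -/
theorem exists_bumped {X Y' : List α} {T : List (List α)} {y : α} (hne : Y' ≠ [])
    (hT : IsIncreasing T) (hX : X.Pairwise (· < ·)) (hD : X ≠ [] → Dominates X Y')
    (hy : Admissible Y' T y) :
    ∃ Y a, IsIncreasing (Y :: T) ∧ Admissible X (Y :: T) a ∧ insertRow X Y a = .bumped Y' y := by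
  obtain ⟨hY', h | ⟨p, x, hp, hxy, hx0, hp1, hDT⟩⟩ := hy
  · exact absurd h hne
  obtain ⟨hpl, hpx⟩ := List.getElem?_eq_some_iff.1 hp
  have hgt : ∀ (j : ℕ) z, p < j → Y'[j]? = some z → y < z := by
    intro j z hj hz
    have hjl := (List.getElem?_eq_some_iff.1 hz).1
    have h1 := List.getElem?_eq_getElem (show p + 1 < Y'.length by omega)
    refine (hp1 _ h1).trans_le ?_
    by_contra hc
    have := (sorted_lt_iff hY' hz h1).1 (not_le.1 hc)
    omega
  rcases hxy.lt_or_eq with hxy | rfl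
  · -- The entry `x` has replaced `y`.
    have hY : (Y'.set p y).Pairwise (· < ·) :=
      sorted_set hY' (fun j z hj hz => (sorted_lt hY' hz hp hj).trans hxy) hgt
    have hgx : ∀ (j : ℕ) z, p ≤ j → (Y'.set p y)[j]? = some z → x < z := by
      intro j z hj hz
      rcases hj.eq_or_lt with rfl | hj
      · grind
      · exact hxy.trans (hgt j z hj (by grind))
    have hs : RowStep X (Y'.set p y) x (.bumped ((Y'.set p y).set p x) y) := by
      refine .replace p y (by simp [hpl]) hxy (fun j z hj hz => ?_) fun x' hx' => ?_
      · exact sorted_lt hY' (by grind) hp hj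
      · have hne : X ≠ [] := by rintro rfl; simp at hx'
        obtain ⟨x'', hx'', hlt⟩ := hD hne p x hp
        grind
    have hset : (Y'.set p y).set p x = Y' := by
      rw [List.set_set, ← hpx, List.set_getElem_self]
    rw [hset] at hs
    refine ⟨Y'.set p y, x, ⟨by simpa using hne, hY, fun Z hZ j z hz => ?_, hT⟩, ?_, hs.eq hY⟩
    · obtain ⟨h1, h2⟩ := hDT Z hZ
      obtain ⟨w, hw, hwz⟩ := h1 j z hz
      by_cases hj : p = j
      · subst hj
        exact ⟨y, by simp [hpl], h2 z hz⟩
      · exact ⟨w, by grind, hwz⟩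
    · by_cases hXe : X = []
      · exact ⟨hX, .inl hXe⟩
      obtain ⟨x', hx', hlt⟩ := hD hXe p x hp
      refine admissible_of_le hX hx' hlt.le (fun h => absurd h hlt.ne) fun Z hZ => ?_
      obtain rfl : Y'.set p y = Z := by simpa using hZ
      refine ⟨fun j z hz => ?_, hgx⟩
      by_cases hj : p = j
      · subst hj
        exact ⟨x', hx', hlt.trans (by grind)⟩
      · exact hD hXe j z (by grind)
  · -- The row has not been changed; the letter is the entry before `x` or the entry above `x`.
    have hp0 := hx0 rfl
    have hb := List.getElem?_eq_getElem (show p - 1 < Y'.length by omega)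
    set b := Y'[p - 1] with hb_def
    have hbx : b < x := sorted_lt hY' hb hp (by omega)
    have hle : ∀ (j : ℕ) z, j < p → Y'[j]? = some z → z ≤ b := by
      intro j z hj hz
      by_contra hc
      have := (sorted_lt_iff hY' hb hz).1 (not_le.1 hc)
      omega
    have hge : ∀ (j : ℕ) z, p ≤ j → Y'[j]? = some z → x ≤ z := by
      intro j z hj hz
      rcases hj.eq_or_lt with rfl | hj
      · grind
      · exact (hgt j z hj hz).le
    have hinc : IsIncreasing (Y' :: T) := ⟨hne, hY', fun Z hZ => (hDT Z hZ).1, hT⟩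
    by_cases hXe : X = []
    · have hs : RowStep X Y' b (.bumped Y' x) :=
        .keep p x hp hbx hle (.inl (List.mem_of_getElem? hb))
      exact ⟨Y', b, hinc, ⟨hX, .inl hXe⟩, hs.eq hY'⟩
    · obtain ⟨x', hx', hlt⟩ := hD hXe p x hp
      have hmax : max b x' < x := max_lt hbx hlt
      have hs : RowStep X Y' (max b x') (.bumped Y' x) := by
        refine .keep p x hp hmax (fun j z hj hz => (hle j z hj hz).trans (le_max_left _ _)) ?_
        rcases max_choice b x' with h | h <;> rw [h]
        · exact .inl (List.mem_of_getElem? hb)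
        · tauto
      refine ⟨Y', max b x', hinc, ?_, hs.eq hY'⟩
      refine admissible_of_le hX hx' (le_max_right _ _) (fun _ => hp0) fun Z hZ => ?_
      obtain rfl : Y' = Z := by simpa using hZ
      exact ⟨hD hXe, fun j z hj hz => hmax.trans_le (hge j z hj hz)⟩

/-- Hecke insertion is surjective: every increasing tableau with a marked corner arises from an
insertion that is recorded there, both with a new box (`s = c`) and without one (`s = c + 1`).  In
a lower row the latter requires that the column of the corner ends to the left of the end of the
row above. -/
theorem exists_insertBelow {T' : List (List α)} : ∀ {X : List α} {r c s : ℕ}, IsIncreasing T' →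
    X.Pairwise (· < ·) → (X ≠ [] → ∀ Y ∈ T'.head?, Dominates X Y) → rowLength T' r = c + 1 →
      rowLength T' (r + 1) ≤ c → (s = c ∨ s = c + 1 ∧ (X = [] ∨ c + 1 < X.length)) →
        ∃ T a, IsIncreasing T ∧ Admissible X T a ∧ insertBelow X T a = (T', r, c) ∧
          rowLength T r = s := by
  induction T' with
  | nil => simp
  | cons Y' T' ih =>
    intro X r c s hT hX hD hr hr1 hs
    have hD : X ≠ [] → Dominates X Y' := fun h => hD h Y' (by simp)
    -- Without a new box, the letter disappears in the topmost row of length `c + 1`.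
    by_cases hterm : s = c + 1 ∧ Y'.length = c + 1
    · obtain ⟨rfl, hlen⟩ := hterm
      have hl : X = [] ∨ Y'.length < X.length := by rw [hlen]; simpa using hs
      obtain ⟨a, ha, hins⟩ := exists_insertBelow_vanish hT hX hD hl
      refine ⟨_, a, hT, ha, ?_, hr⟩
      rw [hins, hlen]
      have hc : T'.countP (fun Z => c + 1 ≤ Z.length) = r := by
        have h1 := (lt_countP_iff hT.2.2.2 (Nat.succ_pos c) r).not.2
          (by simpa using Nat.lt_succ_of_le hr1)
        rcases r with _ | r
        · exact Nat.eq_zero_of_not_pos h1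
        · have h2 := (lt_countP_iff hT.2.2.2 (Nat.succ_pos c) r).2 (by simpa using hr.ge)
          exact le_antisymm (not_lt.1 h1) h2
      rw [hc]
      simp
    · rcases r with _ | r
      · have hlen : Y'.length = c + 1 := by simpa using hr
        obtain rfl : s = c := by tauto
        obtain ⟨Y, l, rfl⟩ : ∃ Y l, Y' = Y ++ [l] :=
          ⟨_, _, (List.dropLast_append_getLast hT.1).symm⟩
        obtain rfl : Y.length = s := by simpa using hlen
        exact exists_insertBelow_append hT hX hD (by simpa using hr1)
      · have hne := hT.1
        have hlen : c + 1 ≤ Y'.length := by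
          have := hT.rowLength_anti (Nat.zero_le (r + 1))
          rw [hr] at this
          simpa using this
        obtain ⟨T, y, h1, h2, h3, h4⟩ := ih (s := s) hT.2.2.2 hT.2.1 (fun _ => hT.2.2.1)
          (by simpa using hr) (by simpa using hr1) (by
            rcases hs with hs | ⟨hs, -⟩
            · exact .inl hs
            · exact .inr ⟨hs, .inr (by omega)⟩)
        obtain ⟨Y, a, g1, g2, g3⟩ := exists_bumped hne h1 hX hD h2
        refine ⟨Y :: T, a, g1, g2, ?_, by simpa using h4⟩
        rw [insertBelow, g3]
        simp [h3]

end Inverse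

/-! ### Transposition -/

section Transpose
variable {α : Type*}

/-- The entry of a tableau in row `i` and column `j`. -/
def entry (T : List (List α)) (i j : ℕ) : Option α := T[i]?.bind (·[j]?)

@[simp] theorem entry_cons_zero (Y : List α) (T : List (List α)) (j : ℕ) :
    entry (Y :: T) 0 j = Y[j]? := by simp [entry]

@[simp] theorem entry_cons_succ (Y : List α) (T : List (List α)) (i j : ℕ) :
    entry (Y :: T) (i + 1) j = entry T i j := by simp [entry]

theorem isSome_entry (T : List (List α)) (i j : ℕ) :
    (entry T i j).isSome ↔ j < rowLength T i := by
  unfold entry rowLength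
  cases T[i]? <;> simp

/-- The entries that are skipped by `filterMap` lie at the bottom, so row indices are preserved. -/
theorem getElem?_filterMap_column {T : List (List α)}
    (hT : T.Pairwise fun Y Z => Z.length ≤ Y.length) (i j : ℕ) :
    (T.filterMap fun row => row[j]?)[i]? = entry T i j := by
  induction T generalizing i with
  | nil => simp [entry]
  | cons Y T ih =>
    obtain ⟨h1, h2⟩ := List.pairwise_cons.1 hT
    rcases hY : Y[j]? with _ | y
    · have hl : Y.length ≤ j := List.getElem?_eq_none_iff.1 hY
      have h0 : T.filterMap (fun row => row[j]?) = [] :=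
        List.filterMap_eq_nil_iff.2 fun Z hZ => List.getElem?_eq_none ((h1 Z hZ).trans hl)
      rw [List.filterMap_cons_none (f := fun row : List α => row[j]?) hY, h0]
      cases i with
      | zero => simp [hY]
      | succ i => rw [entry_cons_succ, ← ih h2, h0]; simp
    · rw [List.filterMap_cons_some (f := fun row : List α => row[j]?) hY]
      cases i with
      | zero => simp [hY]
      | succ i => simpa using ih h2 i

theorem getElem?_transposeRows (T : List (List α)) (j : ℕ) :
    (transposeRows T)[j]? =
      if j < rowLength T 0 then some (T.filterMap fun row => row[j]?) else none := by
  have : (T.headD []).length = rowLength T 0 := by cases T <;> simp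
  unfold transposeRows
  rw [this]
  split_ifs with h
  · simp [h]
  · simp; omega

/-- The reverse of the reading word of the transpose reads the columns of `T` from left to right,
each from bottom to top. -/
theorem reverse_readingWord_transposeRows (T : List (List α)) :
    (readingWord (transposeRows T)).reverse =
      (List.range (rowLength T 0)).flatMap fun j => (T.filterMap fun row => row[j]?).reverse := by
  have : (T.headD []).length = rowLength T 0 := by cases T <;> simp
  unfold readingWord transposeRows
  rw [this, List.reverse_flatten, List.map_reverse, List.reverse_reverse, List.map_map,
    List.flatMap_def]
  rfl

theorem flatMap_range_getElem? (Y : List α) (k : ℕ) :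
    ((List.range k).flatMap fun j => Y[j]?.toList) = Y.take k := by
  induction k with
  | zero => simp
  | succ k ih => rw [List.range_succ, List.flatMap_append, ih, List.take_add_one]; simp

theorem prod_map_mul_of_commute {ι M : Type*} [Monoid M] {l : List ι} {u v : ι → M}
    (h : l.Pairwise fun i j => Commute (v i) (u j)) :
    (l.map fun i => u i * v i).prod = (l.map u).prod * (l.map v).prod := by
  induction l with
  | nil => simp
  | cons i l ih =>
    obtain ⟨h1, h2⟩ := List.pairwise_cons.1 h
    have hc : Commute (v i) (l.map u).prod := Commute.list_prod_right _ _ (by simpa using h1)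
    simp only [List.map_cons, List.prod_cons]
    rw [ih h2, mul_assoc, ← mul_assoc (v i), hc.eq]
    simp only [mul_assoc]

theorem wordProd_flatMap {ι M : Type*} [Monoid M] (g : α → M) (l : List ι) (f : ι → List α) :
    wordProd g (l.flatMap f) = (l.map fun i => wordProd g (f i)).prod := by
  induction l with
  | nil => simp
  | cons i l ih => simp [ih]

variable [LinearOrder α]

theorem isIncreasing_iff {T : List (List α)} : IsIncreasing T ↔
    (∀ Y ∈ T, Y ≠ [] ∧ Y.Pairwise (· < ·)) ∧
      ∀ i Y Z, T[i]? = some Y → T[i + 1]? = some Z → Dominates Y Z := by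
  induction T with
  | nil => simp [IsIncreasing]
  | cons X T ih =>
    rw [IsIncreasing, ih]
    constructor
    · rintro ⟨h1, h2, h3, h4, h5⟩
      refine ⟨by simpa using ⟨⟨h1, h2⟩, h4⟩, ?_⟩
      rintro (_ | i) Y Z hY hZ
      · simp only [List.getElem?_cons_zero, Option.some.injEq] at hY
        subst hY
        exact h3 Z (by simpa [List.head?_eq_getElem?] using hZ)
      · exact h5 i Y Z (by simpa using hY) (by simpa using hZ)
    · rintro ⟨h1, h2⟩
      have h3 := h1 X (by simp)
      refine ⟨h3.1, h3.2, fun Z hZ => h2 0 X Z (by simp) ?_, fun Y hY => h1 Y (by simp [hY]),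
        fun i Y Z hY hZ => h2 (i + 1) Y Z (by simpa using hY) (by simpa using hZ)⟩
      simpa [List.head?_eq_getElem?] using hZ

theorem Dominates.trans {X Y Z : List α} (h1 : Dominates X Y) (h2 : Dominates Y Z) :
    Dominates X Z := by
  intro j z hz
  obtain ⟨y, hy, hyz⟩ := h2 j z hz
  obtain ⟨x, hx, hxy⟩ := h1 j y hy
  exact ⟨x, hx, hxy.trans hyz⟩

theorem IsIncreasing.pairwise_dominates {T : List (List α)} (hT : IsIncreasing T) :
    T.Pairwise Dominates := by
  induction T with
  | nil => simp
  | cons Y T ih =>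
    obtain ⟨-, -, hD, hT⟩ := hT
    have ih := ih hT
    refine List.pairwise_cons.2 ⟨fun Z hZ => ?_, ih⟩
    match T, ih, hD, hZ with
    | X :: T, ih, hD, hZ =>
      have hX := hD X (by simp)
      rcases List.mem_cons.1 hZ with rfl | hZ
      · exact hX
      · exact hX.trans ((List.pairwise_cons.1 ih).1 Z hZ)

theorem IsIncreasing.pairwise_length {T : List (List α)} (hT : IsIncreasing T) :
    T.Pairwise fun Y Z => Z.length ≤ Y.length :=
  hT.pairwise_dominates.imp Dominates.length_le

theorem IsIncreasing.ext {T T' : List (List α)} (hT : IsIncreasing T) (hT' : IsIncreasing T')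
    (h : ∀ i j, entry T i j = entry T' i j) : T = T' := by
  induction T generalizing T' with
  | nil =>
    match T' with
    | [] => rfl
    | Y :: T' => exact absurd (h 0 0).symm (by simpa [entry, ← List.head?_eq_getElem?] using hT'.1)
  | cons X T ih =>
    match T' with
    | [] => exact absurd (h 0 0) (by simpa [entry, ← List.head?_eq_getElem?] using hT.1)
    | Y :: T' =>
      congr 1
      · exact List.ext_getElem? fun j => by simpa using h 0 j
      · exact ih hT.2.2.2 hT'.2.2.2 fun i j => by simpa using h (i + 1) j

theorem entry_transposeRows {T : List (List α)} (hT : IsIncreasing T) (i j : ℕ) :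
    entry (transposeRows T) j i = entry T i j := by
  conv_lhs => rw [entry, getElem?_transposeRows]
  split_ifs with h
  · exact getElem?_filterMap_column hT.pairwise_length i j
  · have : ¬ (entry T i j).isSome := by
      rw [isSome_entry]
      have := hT.rowLength_anti (Nat.zero_le i)
      omega
    exact (Option.not_isSome_iff_eq_none.1 this).symm

theorem lt_rowLength_transposeRows {T : List (List α)} (hT : IsIncreasing T) (i j : ℕ) :
    i < rowLength (transposeRows T) j ↔ j < rowLength T i := by
  rw [← isSome_entry, ← isSome_entry, entry_transposeRows hT]

theorem pairwise_column {T : List (List α)} (hT : IsIncreasing T) (j : ℕ) :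
    (T.filterMap fun row => row[j]?).Pairwise (· < ·) := by
  rw [List.pairwise_filterMap]
  refine hT.pairwise_dominates.imp fun {Y Z} h y hy z hz => ?_
  obtain ⟨x, hx, hxz⟩ := h j z hz
  grind

theorem isIncreasing_transposeRows {T : List (List α)} (hT : IsIncreasing T) :
    IsIncreasing (transposeRows T) := by
  rw [isIncreasing_iff]
  refine ⟨fun C hC => ?_, fun j C D hC hD i z hz => ?_⟩
  · obtain ⟨j, hj⟩ := List.mem_iff_getElem?.1 hC
    rw [getElem?_transposeRows] at hj
    split_ifs at hj with h
    obtain rfl := Option.some.inj hj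
    refine ⟨fun h0 => ?_, pairwise_column hT j⟩
    have := getElem?_filterMap_column hT.pairwise_length 0 j
    rw [h0] at this
    have h1 := (isSome_entry T 0 j).2 h
    rw [← this] at h1
    simp at h1
  · have h1 : ∀ {k C}, (transposeRows T)[k]? = some C → ∀ i, C[i]? = entry T i k := by
      intro k C hC i
      rw [← entry_transposeRows hT, entry, hC]
      rfl
    rw [h1 hD] at hz
    have h2 : j < rowLength T i := by
      have := (isSome_entry T i (j + 1)).1 (by simp [hz])
      omega
    obtain ⟨y, hy⟩ := Option.isSome_iff_exists.1 ((isSome_entry T i j).2 h2)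
    refine ⟨y, (h1 hC i).trans hy, ?_⟩
    unfold entry at hy hz
    rcases hTi : T[i]? with _ | Y
    · simp [hTi] at hy
    · rw [hTi] at hy hz
      exact sorted_lt ((isIncreasing_iff.1 hT).1 Y (List.mem_of_getElem? hTi)).2 hy hz (by omega)

theorem transposeRows_transposeRows {T : List (List α)} (hT : IsIncreasing T) :
    transposeRows (transposeRows T) = T := by
  have hT' := isIncreasing_transposeRows hT
  refine (isIncreasing_transposeRows hT').ext hT fun i j => ?_
  rw [entry_transposeRows hT', entry_transposeRows hT]

/-- The column word and the row word of an increasing tableau represent the same element; only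
commutations are needed. -/
theorem wordProd_columns {M : Type*} [Monoid M] {g : α → M} (hg : IsHeckeFamily g)
    {T : List (List α)} (hT : IsIncreasing T) {k : ℕ} (hk : rowLength T 0 ≤ k) :
    wordProd g ((List.range k).flatMap fun j => (T.filterMap fun row => row[j]?).reverse) =
      wordProd g (readingWord T) := by
  induction T with
  | nil => rw [wordProd_flatMap]; simp [readingWord]
  | cons Y T ih =>
    have hD := List.pairwise_cons.1 hT.pairwise_dominates
    have hY := hT.2.1
    have hk : Y.length ≤ k := by simpa using hk
    rw [readingWord_cons, wordProd_append, ← ih hT.2.2.2 ((hT.rowLength_le 0).trans hk)]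
    conv_rhs => rw [← List.take_of_length_le hk, ← flatMap_range_getElem?]
    rw [wordProd_flatMap, wordProd_flatMap, wordProd_flatMap, ← prod_map_mul_of_commute]
    · congr 1
      refine List.map_congr_left fun j _ => ?_
      rw [← wordProd_append]
      rcases hj : Y[j]? with _ | y
      · rw [List.filterMap_cons_none (f := fun row : List α => row[j]?) hj]; simp
      · rw [List.filterMap_cons_some (f := fun row : List α => row[j]?) hj]; simp
    · refine List.pairwise_lt_range.imp fun {i j} hij => ?_
      rcases hi : Y[i]? with _ | y
      · simp
      · simp only [Option.toList_some, wordProd_cons, wordProd_nil, mul_one]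
        refine (commute_wordProd fun z hz => ?_).symm
        rw [List.mem_reverse, List.mem_filterMap] at hz
        obtain ⟨Z, hZ, hz⟩ := hz
        obtain ⟨x, hx, hxz⟩ := hD.1 Z hZ j z hz
        exact (hg.comm _ _ _ (sorted_lt hY hi hx hij) hxz).symm

end Transpose

/-! ### Young diagrams -/

section Shapes
variable {α : Type*}

theorem HasShape.rowLen_eq {T : List (List α)} {μ : YoungDiagram} (h : HasShape T μ) (i : ℕ) :
    μ.rowLen i = rowLength T i := by
  have h1 : (T.map List.length)[i]? = μ.rowLens[i]? := by rw [h]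
  unfold rowLength
  by_cases hi : i < μ.rowLens.length
  · rw [List.getElem?_eq_getElem hi, YoungDiagram.get_rowLens, List.getElem?_map] at h1
    rcases hT : T[i]? with _ | Y
    · simp [hT] at h1
    · simp only [hT, Option.map_some, Option.some.injEq] at h1
      simp [h1]
  · rw [List.getElem?_eq_none (not_lt.1 hi), List.getElem?_map] at h1
    rcases hT : T[i]? with _ | Y
    · simp only [Option.getD_none, List.length_nil]
      rw [YoungDiagram.length_rowLens, ← YoungDiagram.mem_iff_lt_colLen,
        YoungDiagram.mem_iff_lt_rowLen] at hi
      omega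
    · simp [hT] at h1

theorem HasShape.mem_iff {T : List (List α)} {μ : YoungDiagram} (h : HasShape T μ) (i j : ℕ) :
    (i, j) ∈ μ ↔ j < rowLength T i := by
  rw [YoungDiagram.mem_iff_lt_rowLen, h.rowLen_eq]

variable [LinearOrder α]

theorem exists_hasShape {T : List (List α)} (hT : IsIncreasing T) :
    ∃ μ : YoungDiagram, HasShape T μ := by
  have hs : (T.map List.length).SortedGE := by
    rw [List.sortedGE_iff_pairwise, List.pairwise_map]
    exact hT.pairwise_length
  refine ⟨YoungDiagram.ofRowLens _ hs, ?_⟩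
  rw [HasShape, YoungDiagram.rowLens_ofRowLens_eq_self]
  intro x hx
  obtain ⟨Y, hY, rfl⟩ := List.mem_map.1 hx
  exact List.length_pos_iff.2 ((isIncreasing_iff.1 hT).1 Y hY).1

theorem isHeckeTableau_iff {n : ℕ} {ω : Equiv.Perm (Fin (n + 1))} {μ : YoungDiagram}
    {P : List (List (Fin n))} : IsHeckeTableau ω μ P ↔
      HasShape P μ ∧ IsIncreasing P ∧ IsHeckeWord ω (readingWord P) := by
  constructor
  · rintro ⟨h1, h2, h3, h4⟩
    have hlen : P.Pairwise fun Y Z => Z.length ≤ Y.length := by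
      have := μ.rowLens_sorted
      rw [List.sortedGE_iff_pairwise, ← show _ = _ from h1, List.pairwise_map] at this
      exact this
    refine ⟨h1, isIncreasing_iff.2 ⟨fun Y hY => ⟨?_, h2 Y hY⟩, fun i Y Z hY hZ j z hz => ?_⟩, h4⟩
    · have : Y.length ∈ μ.rowLens := by
        rw [← show _ = _ from h1]; exact List.mem_map_of_mem hY
      exact List.length_pos_iff.1 (μ.pos_of_mem_rowLens _ this)
    · have hj : ∀ k, j < rowLength P k → j < rowLength P 0 := by
        intro k hk
        rw [← h1.mem_iff] at hk ⊢
        exact μ.up_left_mem (Nat.zero_le _) le_rfl hk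
      have hjZ : entry P (i + 1) j = some z := by simp [entry, hZ, hz]
      have hj0 := hj (i + 1) ((isSome_entry _ _ _).1 (by simp [hjZ]))
      have hjY : j < Y.length := by
        have hij : (i, j) ∈ μ := μ.up_left_mem (Nat.le_succ i) le_rfl
          ((h1.mem_iff (i + 1) j).2 ((isSome_entry _ _ _).1 (by simp [hjZ])))
        rw [h1.mem_iff, rowLength, hY] at hij
        simpa using hij
      have hy := List.getElem?_eq_getElem hjY
      have hC : (P.filterMap fun row => row[j]?).Pairwise (· < ·) :=
        h3 _ (List.mem_of_getElem? (i := j) (by rw [getElem?_transposeRows, if_pos hj0]))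
      refine ⟨_, hy, sorted_lt hC (i := i) (j := i + 1) ?_ ?_ (Nat.lt_succ_self i)⟩
      · rw [getElem?_filterMap_column hlen, entry, hY]; exact hy
      · rw [getElem?_filterMap_column hlen, hjZ]
  · rintro ⟨h1, h2, h3⟩
    refine ⟨h1, fun Y hY => ((isIncreasing_iff.1 h2).1 Y hY).2, fun C hC => ?_, h3⟩
    exact ((isIncreasing_iff.1 (isIncreasing_transposeRows h2)).1 C hC).2

end Shapes

/-! ### Insertion of biwords -/

section Biwords
variable {α : Type*} [LinearOrder α] {β : Type*} [LinearOrder β]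

/-- The pair `S` consists of an increasing tableau and a set-valued tableau of the same shape whose
entries increase weakly along rows and columns. -/
structure IsRecordingPair (S : List (List α) × (ℕ → ℕ → Finset β)) : Prop where
  increasing : IsIncreasing S.1
  nonempty_iff : ∀ i j, (S.2 i j).Nonempty ↔ j < rowLength S.1 i
  row_le : ∀ i j, ∀ a ∈ S.2 i j, ∀ b ∈ S.2 i (j + 1), a ≤ b
  col_le : ∀ i j, ∀ a ∈ S.2 i j, ∀ b ∈ S.2 (i + 1) j, a ≤ b

/-- The order of the letters of a semistandard biword: the labels increase weakly, and the letters
with equal labels decrease strictly. -/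
def BiwordLt (p q : β × α) : Prop := p.1 < q.1 ∨ p.1 = q.1 ∧ q.2 < p.2

theorem BiwordLt.trans {p q s : β × α} (h1 : BiwordLt p q) (h2 : BiwordLt q s) : BiwordLt p s := by
  unfold BiwordLt at *
  grind

theorem BiwordLt.irrefl (p : β × α) : ¬ BiwordLt p p := by
  unfold BiwordLt
  simp

theorem BiwordLt.fst_le {p q : β × α} (h : BiwordLt p q) : p.1 ≤ q.1 :=
  h.elim le_of_lt fun h => h.1.le

/-- A semistandard biword all of whose labels are new, that is, do not satisfy `O`. -/
structure IsBiword (O : β → Prop) (w : List (β × α)) : Prop where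
  pairwise : w.Pairwise BiwordLt
  new : ∀ p ∈ w, ¬ O p.1

theorem IsBiword.of_append {O : β → Prop} {v w : List (β × α)} (h : IsBiword O (v ++ w)) :
    IsBiword O v :=
  ⟨(List.pairwise_append.1 h.1).1, fun p hp => h.2 p (by simp [hp])⟩

/-- A recording pair all of whose labels are old, that is, satisfy `O`. -/
structure IsStart (O : β → Prop) (S : List (List α) × (ℕ → ℕ → Finset β)) : Prop extends
    IsRecordingPair S where
  old : ∀ i j, ∀ x ∈ S.2 i j, O x

/-- No new label appears twice in a row. -/
def RowUnique (O : β → Prop) (Q : ℕ → ℕ → Finset β) : Prop :=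
  ∀ x, ¬ O x → ∀ i j j', x ∈ Q i j → x ∈ Q i j' → j = j'

end Biwords

section InsertPairs
variable {α : Type*} [LinearOrder α] {β : Type*} [DecidableEq β]

theorem mem_addEntry {Q : ℕ → ℕ → Finset β} {r c i j : ℕ} {b x : β} :
    x ∈ addEntry Q r c b i j ↔ x ∈ Q i j ∨ x = b ∧ i = r ∧ j = c := by
  unfold addEntry
  split_ifs with h
  · simp [h, or_comm]
  · simp [h]

theorem admissible_nil (T : List (List α)) (a : α) : Admissible [] T a := ⟨by simp, .inl rfl⟩

/-- The box in which the insertion of `a` into `T` is recorded. -/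
def recordBox (T : List (List α)) (a : α) : ℕ × ℕ := (insertBelow [] T a).2

theorem mem_insertStep {S : List (List α) × (ℕ → ℕ → Finset β)} {a : α} {b x : β} {i j : ℕ} :
    x ∈ (insertStep b S a).2 i j ↔ x ∈ S.2 i j ∨ x = b ∧ (i, j) = recordBox S.1 a := by
  rw [insertStep, mem_addEntry, Prod.ext_iff]
  rfl

/-- Hecke insertion of a biword, whose pairs consist of a label and a letter. -/
def insertPairs (S : List (List α) × (ℕ → ℕ → Finset β)) (w : List (β × α)) :
    List (List α) × (ℕ → ℕ → Finset β) :=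
  w.foldl (fun S p => insertStep p.1 S p.2) S

theorem insertPairs_concat (S : List (List α) × (ℕ → ℕ → Finset β)) (w : List (β × α)) (p : β × α) :
    insertPairs S (w ++ [p]) = insertStep p.1 (insertPairs S w) p.2 := by
  simp [insertPairs]

end InsertPairs

section Recording
variable {α : Type*} [LinearOrder α] {β : Type*} [LinearOrder β] [DecidableEq β]

theorem IsRecordingPair.insertStep {S : List (List α) × (ℕ → ℕ → Finset β)}
    (hS : IsRecordingPair S) (a : α) {b : β} (hb : ∀ i j, ∀ x ∈ S.2 i j, x ≤ b) :
    IsRecordingPair (insertStep b S a) := by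
  have hT := (isIncreasing_insertBelow hS.increasing (admissible_nil S.1 a)).1
  have hshape := rowLength_insertBelow hS.increasing (admissible_nil S.1 a) rfl
  rcases hrc : recordBox S.1 a with ⟨r, c⟩
  rw [show (insertBelow [] S.1 a).2.1 = r from congrArg Prod.fst hrc,
    show (insertBelow [] S.1 a).2.2 = c from congrArg Prod.snd hrc] at hshape
  obtain ⟨h1, h2, h3, h4⟩ := hshape
  have hempty : ∀ i j, rowLength S.1 i ≤ j → ∀ x, x ∉ S.2 i j := by
    intro i j hij x hx
    exact absurd ((hS.nonempty_iff i j).1 ⟨x, hx⟩) (not_lt.2 hij)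
  refine ⟨hT, fun i j => ?_, fun i j x hx y hy => ?_, fun i j x hx y hy => ?_⟩
  · have : ((DoubleHecke.insertStep b S a).2 i j).Nonempty ↔
        (S.2 i j).Nonempty ∨ i = r ∧ j = c := by
      simp only [Finset.Nonempty, mem_insertStep, hrc, Prod.mk.injEq]
      constructor
      · rintro ⟨x, hx | hx⟩
        · exact .inl ⟨x, hx⟩
        · exact .inr hx.2
      · rintro (⟨x, hx⟩ | h)
        · exact ⟨x, .inl hx⟩
        · exact ⟨b, .inr ⟨rfl, h⟩⟩
    rw [this, hS.nonempty_iff]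
    change _ ↔ j < rowLength (insertBelow [] S.1 a).1 i
    by_cases hi : i = r
    · subst hi
      omega
    · rw [h1 i hi]
      omega
  · rw [mem_insertStep, hrc, Prod.mk.injEq] at hx hy
    rcases hx with hx | ⟨rfl, rfl, rfl⟩ <;> rcases hy with hy | ⟨rfl, hy, hy'⟩
    · exact hS.row_le i j x hx y hy
    · exact hb _ _ x hx
    · exact absurd hy (hempty _ _ (by omega) y)
    · omega
  · rw [mem_insertStep, hrc, Prod.mk.injEq] at hx hy
    rcases hx with hx | ⟨rfl, rfl, rfl⟩ <;> rcases hy with hy | ⟨rfl, hy, hy'⟩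
    · exact hS.col_le i j x hx y hy
    · exact hb _ _ x hx
    · exact absurd hy (hempty _ _ (by rw [← h1 _ (by omega)]; exact h3) y)
    · omega

/-- Properties of the pair `S` that arises from `S₀` by the insertion of the biword `w`: the old
labels are unchanged, the new labels occur with the same multiplicities as in `w`, and the last
label occurs nowhere below the box in which it has been recorded last. -/
structure InsertionSpec (O : β → Prop) (S₀ : List (List α) × (ℕ → ℕ → Finset β))
    (w : List (β × α)) (S : List (List α) × (ℕ → ℕ → Finset β)) : Prop extends
    IsRecordingPair S where
  mem_old : ∀ x, O x → ∀ i j, x ∈ S.2 i j ↔ x ∈ S₀.2 i j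
  mem_new : ∀ x, ¬ O x → ∀ i j, x ∈ S.2 i j → x ∈ w.map Prod.fst
  rowUnique : RowUnique O S.2
  finite : ∀ x, ¬ O x → {c : ℕ × ℕ | x ∈ S.2 c.1 c.2}.Finite
  ncard : ∀ x, ¬ O x → {c : ℕ × ℕ | x ∈ S.2 c.1 c.2}.ncard = (w.map Prod.fst).count x
  last : ∀ v p, w = v ++ [p] →
    ∀ i j, p.1 ∈ S.2 i j → i ≤ (recordBox (insertPairs S₀ v).1 p.2).1

/-- All labels that are present do not exceed the label of the next letter; where the latter is
present already, it stands above the box in which it will be recorded next. -/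
theorem InsertionSpec.next {O : β → Prop} (hO : ∀ x y, O x → ¬ O y → x < y)
    {S₀ : List (List α) × (ℕ → ℕ → Finset β)} {v : List (β × α)} {p : β × α}
    (hw : IsBiword O (v ++ [p]))
    (hinc : ∀ u q, v = u ++ [q] → IsIncreasing (insertPairs S₀ u).1)
    (h : InsertionSpec O S₀ v (insertPairs S₀ v)) :
    (∀ i j, ∀ x ∈ (insertPairs S₀ v).2 i j, x ≤ p.1) ∧
      ∀ i j, p.1 ∈ (insertPairs S₀ v).2 i j → i < (recordBox (insertPairs S₀ v).1 p.2).1 := by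
  have hp : ¬ O p.1 := hw.new p (by simp)
  have hlt : ∀ q ∈ v, BiwordLt q p := fun q hq =>
    (List.pairwise_append.1 hw.pairwise).2.2 q hq p (by simp)
  constructor
  · intro i j x hx
    by_cases hxO : O x
    · exact (hO x p.1 hxO hp).le
    · obtain ⟨q, hq, rfl⟩ := List.mem_map.1 (h.mem_new x hxO i j hx)
      exact (hlt q hq).fst_le
  · intro i j hx
    obtain ⟨q, hq, hqp⟩ := List.mem_map.1 (h.mem_new p.1 hp i j hx)
    rcases List.eq_nil_or_concat v with rfl | ⟨u, s, rfl⟩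
    · simp at hq
    rw [List.concat_eq_append] at *
    have hsp := hlt s (by simp)
    have hqs : q.1 ≤ s.1 := by
      rcases List.mem_append.1 hq with hq | hq
      · exact ((List.pairwise_append.1 hw.of_append.pairwise).2.2 q hq s (by simp)).fst_le
      · rw [List.mem_singleton.1 hq]
    have hsp1 : s.1 = p.1 := le_antisymm hsp.fst_le (hqp ▸ hqs)
    have hsp2 : p.2 < s.2 := by
      rcases hsp with hsp | hsp
      · exact absurd hsp1 hsp.ne
      · exact hsp.2
    refine (h.last u s rfl i j (hsp1 ▸ hx)).trans_lt ?_
    rw [insertPairs_concat]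
    exact record_lt_record (hinc u s rfl) (admissible_nil _ _) (admissible_nil _ _) (.inl rfl) hsp2

/-- Insertion of a semistandard biword yields a recording pair whose new labels record the biword;
the Pieri property keeps equal labels in different rows. -/
theorem insertionSpec_insertPairs {O : β → Prop} (hO : ∀ x y, O x → ¬ O y → x < y)
    {S₀ : List (List α) × (ℕ → ℕ → Finset β)} (hS₀ : IsStart O S₀) (w : List (β × α))
    (hw : IsBiword O w) : InsertionSpec O S₀ w (insertPairs S₀ w) := by
  have key : ∀ n (w : List (β × α)), w.length = n → IsBiword O w →
      InsertionSpec O S₀ w (insertPairs S₀ w) := by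
    intro n
    induction n using Nat.strong_induction_on with
    | _ n ih =>
      intro w hn hw
      rcases List.eq_nil_or_concat w with rfl | ⟨v, p, rfl⟩
      · have hnew : ∀ x, ¬ O x → ∀ i j, x ∉ S₀.2 i j := fun x hx i j h => hx (hS₀.old i j x h)
        have hset : ∀ x, ¬ O x → {c : ℕ × ℕ | x ∈ S₀.2 c.1 c.2} = ∅ := fun x hx =>
          Set.eq_empty_of_forall_notMem fun c hc => hnew x hx c.1 c.2 hc
        refine ⟨hS₀.toIsRecordingPair, fun x hx i j => Iff.rfl, fun x hx i j h => ?_,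
          fun x hx i j j' h => ?_, fun x hx => ?_, fun x hx => ?_, ?_⟩
        · exact absurd h (hnew x hx i j)
        · exact absurd h (hnew x hx i j)
        · exact (hset x hx) ▸ Set.finite_empty
        · simp only [insertPairs, List.foldl_nil, List.map_nil, List.count_nil]
          rw [hset x hx, Set.ncard_empty]
        · simp
      · rw [List.concat_eq_append] at *
        simp only [List.length_append, List.length_singleton] at hn
        have hv := ih v.length (by omega) v rfl hw.of_append
        obtain ⟨h1, h2⟩ := hv.next hO hw fun u q hu =>
          (ih u.length (by simp [hu] at hn; omega) u rfl (by
            subst hu; exact hw.of_append.of_append)).increasing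
        have hp : ¬ O p.1 := hw.new p (by simp)
        have hnot : p.1 ∉ (insertPairs S₀ v).2 (recordBox (insertPairs S₀ v).1 p.2).1
            (recordBox (insertPairs S₀ v).1 p.2).2 := fun h => lt_irrefl _ (h2 _ _ h)
        have hset : ∀ x, {c : ℕ × ℕ | x ∈ (insertStep p.1 (insertPairs S₀ v) p.2).2 c.1 c.2} =
            if x = p.1 then
              insert (recordBox (insertPairs S₀ v).1 p.2)
                {c : ℕ × ℕ | x ∈ (insertPairs S₀ v).2 c.1 c.2}
            else {c : ℕ × ℕ | x ∈ (insertPairs S₀ v).2 c.1 c.2} := by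
          intro x
          ext c
          rw [Set.mem_ofPred_eq, mem_insertStep]
          split_ifs with h
          · simp [h, or_comm]
          · simp [h]
        rw [insertPairs_concat]
        refine ⟨hv.toIsRecordingPair.insertStep p.2 h1, fun x hx i j => ?_, fun x hx i j h => ?_,
          fun x hx i j j' h h' => ?_, fun x hx => ?_, fun x hx => ?_, fun u q hu i j h => ?_⟩
        · rw [mem_insertStep, hv.mem_old x hx, or_iff_left]
          rintro ⟨rfl, -⟩
          exact hp hx
        · rw [mem_insertStep] at h
          rcases h with h | ⟨rfl, -⟩
          · simpa using Or.inl (by simpa using hv.mem_new x hx i j h)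
          · simp
        · rw [mem_insertStep] at h h'
          rcases h with h | ⟨rfl, h⟩ <;> rcases h' with h' | ⟨h'', h'⟩
          · exact hv.rowUnique x hx i j j' h h'
          · subst h''
            exact absurd (h2 i j h) (by rw [← h']; simp)
          · exact absurd (h2 i j' h') (by rw [← h]; simp)
          · exact congrArg Prod.snd (h.trans h'.symm)
        · rw [hset]
          split_ifs
          · exact (hv.finite x hx).insert _
          · exact hv.finite x hx
        · rw [hset, List.map_append, List.count_append, ← hv.ncard x hx]
          split_ifs with h
          · subst h
            rw [Set.ncard_insert_of_notMem (by simpa using hnot) (hv.finite _ hx)]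
            simp
          · simp [Ne.symm h]
        · obtain ⟨rfl, rfl⟩ : v = u ∧ p = q := by
            simpa using List.append_inj' hu rfl
          rw [mem_insertStep] at h
          rcases h with h | ⟨-, h⟩
          · exact (h2 i j h).le
          · rw [← h]
  exact key _ w rfl hw

end Recording

/-! ### Recovering a biword from its recording tableau -/

section RecordingInverse
variable {α : Type*} [LinearOrder α] {β : Type*} [LinearOrder β]

/-- The box in row `r` and column `c` is the lowest one that contains the greatest new label `b`. -/
structure IsLastEntry (O : β → Prop) (Q : ℕ → ℕ → Finset β) (b : β) (r c : ℕ) : Prop where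
  mem : b ∈ Q r c
  new : ¬ O b
  max : ∀ x i j, ¬ O x → x ∈ Q i j → x < b ∨ x = b ∧ i ≤ r

theorem IsLastEntry.unique {O : β → Prop} {Q : ℕ → ℕ → Finset β} (hQ : RowUnique O Q)
    {b b' : β} {r r' c c' : ℕ} (h : IsLastEntry O Q b r c) (h' : IsLastEntry O Q b' r' c') :
    b = b' ∧ r = r' ∧ c = c' := by
  have h1 := h.max b' r' c' h'.new h'.mem
  have h2 := h'.max b r c h.new h.mem
  obtain rfl : b = b' := by
    rcases h1 with h1 | h1 <;> rcases h2 with h2 | h2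
    · exact absurd h1 (lt_asymm h2)
    · exact h2.1
    · exact h1.1.symm
    · exact h2.1
  obtain rfl : r = r' := by
    simp only [lt_irrefl, true_and, false_or] at h1 h2
    omega
  exact ⟨rfl, rfl, hQ b h.new r c c' h.mem h'.mem⟩

theorem IsLastEntry.corner {O : β → Prop} (hO : ∀ x y, O x → ¬ O y → x < y)
    {S : List (List α) × (ℕ → ℕ → Finset β)} (hS : IsRecordingPair S) (hQ : RowUnique O S.2)
    {b : β} {r c : ℕ} (h : IsLastEntry O S.2 b r c) :
    rowLength S.1 r = c + 1 ∧ rowLength S.1 (r + 1) ≤ c := by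
  have key : ∀ i j x, x ∈ S.2 i j → b ≤ x → x = b ∧ i ≤ r := by
    intro i j x hx hbx
    have hxO : ¬ O x := fun hO' => absurd (hO x b hO' h.new) (not_lt.2 hbx)
    exact (h.max x i j hxO hx).resolve_left (not_lt.2 hbx)
  constructor
  · refine le_antisymm ?_ ((hS.nonempty_iff r c).1 ⟨b, h.mem⟩)
    by_contra hc
    obtain ⟨x, hx⟩ := (hS.nonempty_iff r (c + 1)).2 (not_le.1 hc)
    obtain ⟨rfl, -⟩ := key _ _ x hx (hS.row_le r c b h.mem x hx)
    have := hQ x h.new r c (c + 1) h.mem hx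
    omega
  · by_contra hc
    obtain ⟨x, hx⟩ := (hS.nonempty_iff (r + 1) c).2 (not_le.1 hc)
    have := (key _ _ x hx (hS.col_le r c b h.mem x hx)).2
    omega

theorem IsRecordingPair.finite [Finite β] {S : List (List α) × (ℕ → ℕ → Finset β)}
    (hS : IsRecordingPair S) : {d : β × ℕ × ℕ | d.1 ∈ S.2 d.2.1 d.2.2}.Finite := by
  refine ((Set.finite_univ (α := β)).prod
    ((Set.finite_Iio S.1.length).prod (Set.finite_Iio (rowLength S.1 0)))).subset ?_
  rintro ⟨x, i, j⟩ hx
  have h := (hS.nonempty_iff i j).1 ⟨x, hx⟩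
  refine ⟨trivial, ?_, h.trans_le (hS.increasing.rowLength_anti (Nat.zero_le i))⟩
  by_contra hi
  rw [rowLength, List.getElem?_eq_none (not_lt.1 hi)] at h
  simp at h

theorem exists_isLastEntry [Finite β] {O : β → Prop} {S : List (List α) × (ℕ → ℕ → Finset β)}
    (hS : IsRecordingPair S) {x : β} {i j : ℕ} (hxO : ¬ O x) (hx : x ∈ S.2 i j) :
    ∃ b r c, IsLastEntry O S.2 b r c := by
  have hfin : {d : β × ℕ × ℕ | ¬ O d.1 ∧ d.1 ∈ S.2 d.2.1 d.2.2}.Finite :=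
    hS.finite.subset fun d hd => hd.2
  obtain ⟨⟨b, r, c⟩, hb, hmax⟩ := Set.exists_max_image _
    (fun d : β × ℕ × ℕ => toLex (d.1, d.2.1)) hfin ⟨(x, i, j), hxO, hx⟩
  refine ⟨b, r, c, hb.2, hb.1, fun y k l hy hyQ => ?_⟩
  have := hmax (y, k, l) ⟨hy, hyQ⟩
  simpa [Prod.Lex.toLex_le_toLex] using this

variable [DecidableEq β]

/-- The last letter inserted is recorded in the lowest box that contains the greatest new label. -/
theorem InsertionSpec.isLastEntry {O : β → Prop} (hO : ∀ x y, O x → ¬ O y → x < y)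
    {S₀ : List (List α) × (ℕ → ℕ → Finset β)} (hS₀ : IsStart O S₀) {v : List (β × α)} {p : β × α}
    (hw : IsBiword O (v ++ [p])) :
    IsLastEntry O (insertPairs S₀ (v ++ [p])).2 p.1 (recordBox (insertPairs S₀ v).1 p.2).1
      (recordBox (insertPairs S₀ v).1 p.2).2 ∧
    p.1 ∉ (insertPairs S₀ v).2 (recordBox (insertPairs S₀ v).1 p.2).1
      (recordBox (insertPairs S₀ v).1 p.2).2 := by
  have hv := insertionSpec_insertPairs hO hS₀ v hw.of_append
  obtain ⟨h1, h2⟩ := hv.next hO hw fun u q hu =>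
    (insertionSpec_insertPairs hO hS₀ u (by subst hu; exact hw.of_append.of_append)).increasing
  refine ⟨⟨?_, hw.new p (by simp), fun x i j hx h => ?_⟩, fun h => lt_irrefl _ (h2 _ _ h)⟩
  · rw [insertPairs_concat, mem_insertStep]
    exact .inr ⟨rfl, rfl⟩
  · rw [insertPairs_concat, mem_insertStep] at h
    rcases h with h | ⟨rfl, h⟩
    · rcases (h1 i j x h).lt_or_eq with h3 | rfl
      · exact .inl h3
      · exact .inr ⟨rfl, (h2 i j h).le⟩
    · exact .inr ⟨rfl, by rw [← h]⟩

/-- The result of the insertion of a semistandard biword determines the biword and the pair from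
which the insertion has started. -/
theorem insertPairs_injective {O : β → Prop} (hO : ∀ x y, O x → ¬ O y → x < y)
    {S₀ S₀' : List (List α) × (ℕ → ℕ → Finset β)} (hS₀ : IsStart O S₀) (hS₀' : IsStart O S₀')
    {w w' : List (β × α)} (hw : IsBiword O w) (hw' : IsBiword O w')
    (h : insertPairs S₀ w = insertPairs S₀' w') : S₀ = S₀' ∧ w = w' := by
  have absurd_nil : ∀ {S₀ S₀' : List (List α) × (ℕ → ℕ → Finset β)}, IsStart O S₀ →
      IsStart O S₀' → ∀ {v : List (β × α)} {p}, IsBiword O (v ++ [p]) →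
      S₀ ≠ insertPairs S₀' (v ++ [p]) := by
    rintro S₀ S₀' hS₀ hS₀' v p hw rfl
    have := (InsertionSpec.isLastEntry hO hS₀' hw).1
    exact this.new (hS₀.old _ _ _ this.mem)
  induction w using List.reverseRecOn generalizing w' with
  | nil =>
    rcases List.eq_nil_or_concat w' with rfl | ⟨v, p, rfl⟩
    · exact ⟨h, rfl⟩
    · rw [List.concat_eq_append] at *
      exact absurd h (absurd_nil hS₀ hS₀' hw')
  | append_singleton v p ih =>
    rcases List.eq_nil_or_concat w' with rfl | ⟨v', p', rfl⟩
    · exact absurd h.symm (absurd_nil hS₀' hS₀ hw)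
    rw [List.concat_eq_append] at *
    have hv := insertionSpec_insertPairs hO hS₀ v hw.of_append
    have hv' := insertionSpec_insertPairs hO hS₀' v' hw'.of_append
    have hspec := insertionSpec_insertPairs hO hS₀ _ hw
    obtain ⟨h1, h2⟩ := InsertionSpec.isLastEntry hO hS₀ hw
    obtain ⟨h3, h4⟩ := InsertionSpec.isLastEntry hO hS₀' hw'
    rw [← h] at h3
    obtain ⟨e1, e2, e3⟩ := h1.unique hspec.rowUnique h3
    have hbox : recordBox (insertPairs S₀ v).1 p.2 = recordBox (insertPairs S₀' v').1 p'.2 :=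
      Prod.ext e2 e3
    rw [← hbox, ← e1] at h4
    rw [insertPairs_concat, insertPairs_concat] at h
    have hQ : (insertPairs S₀ v).2 = (insertPairs S₀' v').2 := by
      funext i j
      ext x
      have := congrArg (fun S => x ∈ S.2 i j) h
      simp only [mem_insertStep, ← hbox, ← e1, eq_iff_iff] at this
      by_cases hx : x = p.1 ∧ (i, j) = recordBox (insertPairs S₀ v).1 p.2
      · obtain ⟨rfl, hij⟩ := hx
        rw [← hij] at h2 h4
        exact iff_of_false h2 h4
      · simpa [hx] using this
    have hlen : ∀ i, rowLength (insertPairs S₀ v).1 i = rowLength (insertPairs S₀' v').1 i := by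
      intro i
      refine eq_of_forall_lt_iff fun j => ?_
      rw [← hv.nonempty_iff, ← hv'.nonempty_iff, hQ]
    have hfst : (insertBelow [] (insertPairs S₀ v).1 p.2).1 =
        (insertBelow [] (insertPairs S₀' v').1 p'.2).1 := by
      simpa only [insertStep] using congrArg Prod.fst h
    obtain ⟨hT, ha⟩ := insertBelow_injective hv.increasing hv'.increasing (admissible_nil _ _)
      (admissible_nil _ _) hlen (Prod.ext hfst hbox)
    obtain ⟨rfl, rfl⟩ := ih hw.of_append hw'.of_append (Prod.ext hT hQ)
    exact ⟨rfl, by rw [Prod.ext e1 ha]⟩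

/-- Inversion of one insertion step. -/
theorem exists_insertStep {O : β → Prop} (hO : ∀ x y, O x → ¬ O y → x < y)
    {S : List (List α) × (ℕ → ℕ → Finset β)} (hS : IsRecordingPair S) (hQ : RowUnique O S.2)
    {b : β} {r c : ℕ} (hb : IsLastEntry O S.2 b r c) :
    ∃ S₁ a, IsRecordingPair S₁ ∧ recordBox S₁.1 a = (r, c) ∧ insertStep b S₁ a = S ∧
      ∀ x i j, x ∈ S₁.2 i j ↔ x ∈ S.2 i j ∧ ¬ (x = b ∧ i = r ∧ j = c) := by
  obtain ⟨hc1, hc2⟩ := hb.corner hO hS hQ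
  -- The box is new if and only if `b` is its only label.
  obtain ⟨T, a, hT, -, hins, hlen⟩ := exists_insertBelow
    (s := if S.2 r c = {b} then c else c + 1) hS.increasing List.Pairwise.nil (by simp) hc1 hc2
    (by split_ifs <;> simp)
  set Q : ℕ → ℕ → Finset β :=
    fun i j => if i = r ∧ j = c then (S.2 i j).erase b else S.2 i j with hQdef
  have hmem : ∀ x i j, x ∈ Q i j ↔ x ∈ S.2 i j ∧ ¬ (x = b ∧ i = r ∧ j = c) := by
    intro x i j
    rw [hQdef]
    dsimp only
    split_ifs with h
    · rw [Finset.mem_erase]; tauto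
    · tauto
  have hbox : recordBox T a = (r, c) := by rw [recordBox, hins]
  refine ⟨(T, Q), a, ⟨hT, fun i j => ?_, fun i j x hx y hy => ?_, fun i j x hx y hy => ?_⟩, hbox,
    ?_, hmem⟩
  · have hshape := rowLength_insertBelow hT (admissible_nil T a) hins
    by_cases hij : i = r ∧ j = c
    · obtain ⟨rfl, rfl⟩ := hij
      change (Q i j).Nonempty ↔ j < rowLength T i
      rw [hlen]
      have : Q i j = (S.2 i j).erase b := by simp [hQdef]
      rw [this]
      split_ifs with h1
      · simp [h1]
      · refine iff_of_true ?_ (Nat.lt_succ_self j)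
        by_contra h2
        rw [Finset.not_nonempty_iff_eq_empty, Finset.erase_eq_empty_iff] at h2
        rcases h2 with h2 | h2
        · simpa [h2] using hb.mem
        · exact h1 h2
    · have : Q i j = S.2 i j := by simp [hQdef, hij]
      change (Q i j).Nonempty ↔ j < rowLength T i
      rw [this, hS.nonempty_iff]
      by_cases hi : i = r
      · subst hi
        omega
      · rw [hshape.1 i hi]
  · exact hS.row_le i j x ((hmem _ _ _).1 hx).1 y ((hmem _ _ _).1 hy).1
  · exact hS.col_le i j x ((hmem _ _ _).1 hx).1 y ((hmem _ _ _).1 hy).1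
  · refine Prod.ext (by simp [insertStep, hins]) ?_
    funext i j
    ext x
    rw [mem_insertStep, hmem, hbox, Prod.mk.injEq]
    constructor
    · rintro (h | ⟨rfl, rfl, rfl⟩)
      · exact h.1
      · exact hb.mem
    · tauto

/-- Every recording pair in which new labels appear at most once in each row arises from the
insertion of a semistandard biword. -/
theorem exists_insertPairs [Finite β] {O : β → Prop} (hO : ∀ x y, O x → ¬ O y → x < y)
    {S : List (List α) × (ℕ → ℕ → Finset β)} (hS : IsRecordingPair S) (hQ : RowUnique O S.2) :
    ∃ S₀ w, IsStart O S₀ ∧ IsBiword O w ∧ insertPairs S₀ w = S := by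
  induction hn : {d : β × ℕ × ℕ | d.1 ∈ S.2 d.2.1 d.2.2}.ncard using Nat.strong_induction_on
    generalizing S with
  | _ n ih =>
    by_cases hnew : ∀ i j, ∀ x ∈ S.2 i j, O x
    · exact ⟨S, [], ⟨hS, hnew⟩, ⟨List.Pairwise.nil, by simp⟩, rfl⟩
    push Not at hnew
    obtain ⟨i, j, x, hx, hxO⟩ := hnew
    obtain ⟨b, r, c, hb⟩ := exists_isLastEntry hS hxO hx
    obtain ⟨S₁, a, h1, h2, h3, h4⟩ := exists_insertStep hO hS hQ hb
    have hlt : {d : β × ℕ × ℕ | d.1 ∈ S₁.2 d.2.1 d.2.2}.ncard < n := by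
      rw [← hn]
      refine Set.ncard_lt_ncard ?_ hS.finite
      refine ⟨fun d hd => ((h4 _ _ _).1 hd).1, fun hsub => ?_⟩
      have hd : (b, r, c) ∈ {d : β × ℕ × ℕ | d.1 ∈ S₁.2 d.2.1 d.2.2} := hsub hb.mem
      exact ((h4 b r c).1 hd).2 ⟨rfl, rfl, rfl⟩
    obtain ⟨S₀, v, hS₀, hv, rfl⟩ := ih _ hlt h1
      (fun x hx i j j' h h' => hQ x hx i j j' ((h4 _ _ _).1 h).1 ((h4 _ _ _).1 h').1) rfl
    refine ⟨S₀, v ++ [(b, a)], hS₀, ⟨?_, fun p hp => ?_⟩, by rw [insertPairs_concat, h3]⟩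
    · refine List.pairwise_append.2 ⟨hv.pairwise, by simp, ?_⟩
      rcases List.eq_nil_or_concat v with rfl | ⟨u, q, rfl⟩
      · simp
      rw [List.concat_eq_append] at *
      have hqb : BiwordLt q (b, a) := by
        have hq := (InsertionSpec.isLastEntry hO hS₀ hv).1
        have hqS := (h4 _ _ _).1 hq.mem
        rcases hb.max q.1 _ _ hq.new hqS.1 with hlt | ⟨heq, hle⟩
        · exact .inl hlt
        · refine .inr ⟨heq, ?_⟩
          by_contra hle'
          -- Otherwise `b` would be recorded twice in the same box.
          have hu := insertionSpec_insertPairs hO hS₀ u hv.of_append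
          have hrec := record_le_record hu.increasing (admissible_nil _ q.2) (admissible_nil _ a)
            (not_lt.1 hle')
          rw [insertPairs_concat] at h2
          have hr : r ≤ (recordBox (insertPairs S₀ u).1 q.2).1 :=
            (congrArg Prod.fst h2).symm.le.trans hrec
          have hr' := le_antisymm hle hr
          refine hqS.2 ⟨heq, hr', ?_⟩
          refine hQ b hb.new r _ _ ?_ hb.mem
          have := hqS.1
          rwa [heq, hr'] at this
      intro p hp s hs
      rw [List.mem_singleton.1 hs]
      rcases List.mem_append.1 hp with hp | hp
      · exact ((List.pairwise_append.1 hv.pairwise).2.2 p hp q (by simp)).trans hqb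
      · rw [List.mem_singleton.1 hp]
        exact hqb
    · rcases List.mem_append.1 hp with hp | hp
      · exact hv.new p hp
      · rw [List.mem_singleton.1 hp]
        exact hb.new

end RecordingInverse

/-! ### Factorizations as biwords -/

section Factors
variable {α β : Type*} {k : ℕ}

/-- The biword of a sequence of factors, in which the letters of the factor `f i` have the label
`label i`. -/
def biword (label : Fin k → β) (f : Fin k → List α) : List (β × α) :=
  (List.finRange k).flatMap fun i => (f i).map (Prod.mk (label i))

theorem mem_biword {label : Fin k → β} {f : Fin k → List α} {p : β × α} :
    p ∈ biword label f ↔ ∃ i, label i = p.1 ∧ p.2 ∈ f i := by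
  simp only [biword, List.mem_flatMap, List.mem_finRange, true_and, List.mem_map]
  constructor
  · rintro ⟨i, a, ha, rfl⟩
    exact ⟨i, rfl, ha⟩
  · rintro ⟨i, h, ha⟩
    exact ⟨i, p.2, ha, by rw [h]⟩

theorem map_snd_biword (label : Fin k → β) (f : Fin k → List α) :
    (biword label f).map Prod.snd = (List.ofFn f).flatten := by
  rw [biword, List.map_flatMap, List.ofFn_eq_map, List.flatMap_def]
  congr 1
  refine List.map_congr_left fun i _ => ?_
  simp [Function.comp_def]

/-- The multiplicity of a label is the length of its factor. -/
theorem count_biword [DecidableEq β] {label : Fin k → β} (hl : Function.Injective label)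
    (f : Fin k → List α) (i : Fin k) :
    ((biword label f).map Prod.fst).count (label i) = (f i).length := by
  have h : (biword label f).map Prod.fst =
      (List.finRange k).flatMap fun j => List.replicate (f j).length (label j) := by
    rw [biword, List.map_flatMap]
    congr 1
    funext j
    simp [Function.comp_def]
  rw [h, List.count_flatMap, ← Fin.sum_univ_def]
  simp only [Function.comp_apply, List.count_replicate, beq_iff_eq, hl.eq_iff]
  simp

variable [LinearOrder α]

theorem biword_injective {label : Fin k → β} (hl : Function.Injective label)
    {f g : Fin k → List α} (hf : ∀ i, (f i).Pairwise (· > ·)) (hg : ∀ i, (g i).Pairwise (· > ·))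
    (h : biword label f = biword label g) : f = g := by
  funext i
  refine List.Perm.eq_of_pairwise (fun a b _ _ h1 h2 => absurd h1 (lt_asymm h2)) (hf i) (hg i) ?_
  rw [List.perm_ext_iff_of_nodup ((hf i).imp fun h => h.ne') ((hg i).imp fun h => h.ne')]
  intro a
  have key : ∀ f : Fin k → List α, a ∈ f i ↔ (label i, a) ∈ biword label f := by
    intro f
    rw [mem_biword]
    constructor
    · exact fun h => ⟨i, rfl, h⟩
    · rintro ⟨j, hj, ha⟩
      rwa [← hl hj]
  rw [key f, key g, h]

theorem insertFactors_eq [DecidableEq β] (label : Fin k → β) (f : Fin k → List α)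
    (S : List (List α) × (ℕ → ℕ → Finset β)) :
    insertFactors label f S = insertPairs S (biword label f) := by
  unfold insertFactors insertPairs biword
  generalize List.finRange k = l
  induction l generalizing S with
  | nil => rfl
  | cons i l ih => simp [ih, List.foldl_map]

variable [LinearOrder β]

theorem isBiword_biword {O : β → Prop} {label : Fin k → β} (hl : StrictMono label)
    (hO : ∀ i, ¬ O (label i)) {f : Fin k → List α} (hf : ∀ i, (f i).Pairwise (· > ·)) :
    IsBiword O (biword label f) := by
  constructor
  · rw [biword, List.pairwise_flatMap]
    refine ⟨fun i _ => ?_, (List.pairwise_lt_finRange k).imp fun {i j} hij p hp q hq => ?_⟩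
    · rw [List.pairwise_map]
      exact (hf i).imp fun h => .inr ⟨rfl, h⟩
    · obtain ⟨a, -, rfl⟩ := List.mem_map.1 hp
      obtain ⟨b, -, rfl⟩ := List.mem_map.1 hq
      exact .inl (hl hij)
  · intro p hp
    obtain ⟨i, hi, -⟩ := mem_biword.1 hp
    exact hi ▸ hO i

theorem exists_biword {O : β → Prop} {label : Fin k → β} (hl : StrictMono label)
    (hO : ∀ x, ¬ O x ↔ ∃ i, label i = x) {w : List (β × α)} (hw : IsBiword O w) :
    ∃ f : Fin k → List α, (∀ i, (f i).Pairwise (· > ·)) ∧ biword label f = w := by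
  have hf : ∀ i, ((w.filter fun p => p.1 = label i).map Prod.snd).Pairwise (· > ·) := by
    intro i
    rw [List.pairwise_map, List.pairwise_filter]
    refine hw.pairwise.imp fun {p q} hpq hp hq => ?_
    simp only [decide_eq_true_eq] at hp hq
    rcases hpq with h | h
    · exact absurd (hp.trans hq.symm) h.ne
    · exact h.2
  refine ⟨_, hf, ?_⟩
  have hb := (isBiword_biword (O := O) hl (fun i => (hO _).2 ⟨i, rfl⟩) hf).pairwise
  have hne : ∀ {p q : β × α}, BiwordLt p q → p ≠ q := by
    rintro p q h rfl
    exact BiwordLt.irrefl p h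
  refine List.Perm.eq_of_pairwise
    (fun p q _ _ h1 h2 => absurd (h1.trans h2) (BiwordLt.irrefl p)) hb hw.pairwise ?_
  rw [List.perm_ext_iff_of_nodup (hb.imp hne) (hw.pairwise.imp hne)]
  rintro ⟨x, a⟩
  simp only [mem_biword, List.mem_map, List.mem_filter, decide_eq_true_eq]
  constructor
  · rintro ⟨i, rfl, ⟨y, b⟩, ⟨h1, rfl⟩, rfl⟩
    exact h1
  · intro h
    obtain ⟨i, hi⟩ := (hO x).1 (hw.new _ h)
    exact ⟨i, hi, _, ⟨h, hi.symm⟩, rfl⟩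

end Factors

/-! ### The operators on permutations -/

section HeckeOperators
variable {n : ℕ}

/-- The operators `heckeAct i`, as elements of the monoid of self-maps of the permutations. -/
def heckeOperator (i : Fin n) : Function.End (Equiv.Perm (Fin (n + 1))) := heckeAct i

theorem wordProd_heckeOperator_apply (w : List (Fin n)) (σ : Equiv.Perm (Fin (n + 1))) :
    wordProd heckeOperator w σ = w.foldr heckeAct σ := by
  induction w with
  | nil => rfl
  | cons i w ih =>
    rw [wordProd_cons, List.foldr_cons, ← ih]
    rfl

theorem heckeAct_idem (i : Fin n) (σ : Equiv.Perm (Fin (n + 1))) :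
    heckeAct i (heckeAct i σ) = heckeAct i σ := by
  unfold heckeAct
  split_ifs with h1 h2
  · simp only [mul_inv_rev, Equiv.swap_inv, Equiv.Perm.mul_apply, Equiv.swap_apply_left,
      Equiv.swap_apply_right] at h2
    exact absurd h1 (lt_asymm h2)
  all_goals rfl

theorem heckeAct_comm {i j : Fin n} (hij : (i : ℕ) + 1 < j) (σ : Equiv.Perm (Fin (n + 1))) :
    heckeAct i (heckeAct j σ) = heckeAct j (heckeAct i σ) := by
  have h1 : i.castSucc ≠ j.castSucc := by simp [Fin.ext_iff]; omega
  have h2 : i.castSucc ≠ j.succ := by simp [Fin.ext_iff]; omega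
  have h3 : i.succ ≠ j.castSucc := by simp [Fin.ext_iff]; omega
  have h4 : i.succ ≠ j.succ := by simp [Fin.ext_iff]; omega
  have hc : Equiv.swap i.castSucc i.succ * Equiv.swap j.castSucc j.succ =
      Equiv.swap j.castSucc j.succ * Equiv.swap i.castSucc i.succ := by
    refine (Equiv.Perm.disjoint_swap_swap ?_).commute
    simp [h1, h2, h3, h4, Fin.castSucc_lt_succ.ne]
  have e1 : (Equiv.swap j.castSucc j.succ * σ)⁻¹ i.castSucc = σ⁻¹ i.castSucc := by
    simp [Equiv.swap_apply_of_ne_of_ne h1 h2]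
  have e2 : (Equiv.swap j.castSucc j.succ * σ)⁻¹ i.succ = σ⁻¹ i.succ := by
    simp [Equiv.swap_apply_of_ne_of_ne h3 h4]
  have e3 : (Equiv.swap i.castSucc i.succ * σ)⁻¹ j.castSucc = σ⁻¹ j.castSucc := by
    simp [Equiv.swap_apply_of_ne_of_ne h1.symm h3.symm]
  have e4 : (Equiv.swap i.castSucc i.succ * σ)⁻¹ j.succ = σ⁻¹ j.succ := by
    simp [Equiv.swap_apply_of_ne_of_ne h2.symm h4.symm]
  unfold heckeAct
  by_cases c1 : σ⁻¹ i.castSucc < σ⁻¹ i.succ <;> by_cases c2 : σ⁻¹ j.castSucc < σ⁻¹ j.succ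
  · rw [if_pos c1, if_pos c2, e1, e2, e3, e4, if_pos c1, if_pos c2, ← mul_assoc, ← mul_assoc, hc]
  · rw [if_pos c1, if_neg c2, e3, e4, if_neg c2, if_pos c1]
  · rw [if_neg c1, if_pos c2, e1, e2, if_neg c1]
  · rw [if_neg c1, if_neg c2, if_neg c1]

theorem heckeAct_braid {i j : Fin n} (hij : (i : ℕ) + 1 = j) (σ : Equiv.Perm (Fin (n + 1))) :
    heckeAct i (heckeAct j (heckeAct i σ)) = heckeAct j (heckeAct i (heckeAct j σ)) := by
  have hy : j.castSucc = i.succ := by ext; simp; omega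
  have hxy : i.castSucc ≠ i.succ := by simp [Fin.ext_iff]
  have hxz : i.castSucc ≠ j.succ := by simp [Fin.ext_iff]; omega
  have hyz : i.succ ≠ j.succ := by simp [Fin.ext_iff]; omega
  unfold heckeAct
  rw [hy]
  generalize i.castSucc = x at *
  generalize j.succ = z at *
  generalize i.succ = y at *
  have e1 : ∀ (τ : Equiv.Perm (Fin (n + 1))), (Equiv.swap x y * τ)⁻¹ x = τ⁻¹ y := by simp
  have e2 : ∀ (τ : Equiv.Perm (Fin (n + 1))), (Equiv.swap x y * τ)⁻¹ y = τ⁻¹ x := by simp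
  have e3 : ∀ (τ : Equiv.Perm (Fin (n + 1))), (Equiv.swap x y * τ)⁻¹ z = τ⁻¹ z := by
    simp [Equiv.swap_apply_of_ne_of_ne hxz.symm hyz.symm]
  have e4 : ∀ (τ : Equiv.Perm (Fin (n + 1))), (Equiv.swap y z * τ)⁻¹ x = τ⁻¹ x := by
    simp [Equiv.swap_apply_of_ne_of_ne hxy hxz]
  have e5 : ∀ (τ : Equiv.Perm (Fin (n + 1))), (Equiv.swap y z * τ)⁻¹ y = τ⁻¹ z := by simp
  have e6 : ∀ (τ : Equiv.Perm (Fin (n + 1))), (Equiv.swap y z * τ)⁻¹ z = τ⁻¹ y := by simp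
  have hbraid : Equiv.swap x y * (Equiv.swap y z * (Equiv.swap x y * σ)) =
      Equiv.swap y z * (Equiv.swap x y * (Equiv.swap y z * σ)) := by
    have h1 := Equiv.swap_mul_swap_mul_swap hxy hxz
    have h2 := Equiv.swap_mul_swap_mul_swap (x := z) (y := y) (z := x) hyz.symm hxz.symm
    rw [Equiv.swap_comm y x, Equiv.swap_comm z y, Equiv.swap_comm x z] at h2
    simpa only [mul_assoc] using congrArg (· * σ) (h2.trans h1.symm)
  have p1 : σ⁻¹ x ≠ σ⁻¹ y := σ⁻¹.injective.ne hxy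
  have p2 : σ⁻¹ x ≠ σ⁻¹ z := σ⁻¹.injective.ne hxz
  have p3 : σ⁻¹ y ≠ σ⁻¹ z := σ⁻¹.injective.ne hyz
  -- All conditions compare the positions of `x`, `y` and `z`; the order of these positions decides
  -- them.
  rcases p1.lt_or_gt with c1 | c1 <;> rcases p2.lt_or_gt with c2 | c2 <;>
    rcases p3.lt_or_gt with c3 | c3 <;>
    first
    | exact absurd (c1.trans c3) (lt_asymm c2)
    | exact absurd (c3.trans c1) (lt_asymm c2)
    | simp only [e1, e2, e3, e4, e5, e6, c1, c2, c3, not_lt.2 c1.le, not_lt.2 c2.le,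
        not_lt.2 c3.le, if_true, if_false, hbraid]

theorem isHeckeFamily_heckeOperator : IsHeckeFamily (heckeOperator (n := n)) := by
  have comm : ∀ i j : Fin n, (i : ℕ) + 1 < j →
      heckeOperator i * heckeOperator j = heckeOperator j * heckeOperator i :=
    fun i j h => funext fun σ => heckeAct_comm h σ
  have idem : ∀ i : Fin n, heckeOperator i * heckeOperator i = heckeOperator i :=
    fun i => funext fun σ => heckeAct_idem i σ
  have far : ∀ i j : Fin n, (i : ℕ) + 1 < j → heckeOperator i * heckeOperator j * heckeOperator i =
      heckeOperator j * heckeOperator i * heckeOperator j := by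
    intro i j h
    rw [comm i j h, mul_assoc, idem, ← comm i j h, mul_assoc, idem]
  refine ⟨idem, fun i j => ?_, fun i k j hik hkj => comm i j ?_⟩
  · rcases lt_trichotomy (i : ℕ) j with h | h | h
    · rcases (Nat.succ_le_of_lt h).eq_or_lt with h | h
      · exact funext fun σ => heckeAct_braid h σ
      · exact far i j h
    · rw [Fin.ext h]
    · rcases (Nat.succ_le_of_lt h).eq_or_lt with h | h
      · exact funext fun σ => (heckeAct_braid h σ).symm
      · exact (far j i h).symm
  · rw [Fin.lt_def] at hik hkj
    omega

theorem IsHeckeFamily.op {α M : Type*} [LinearOrder α] [Monoid M] {g : α → M}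
    (hg : IsHeckeFamily g) : IsHeckeFamily fun a => MulOpposite.op (g a) := by
  refine ⟨fun a => ?_, fun a b => ?_, fun a b c h1 h2 => ?_⟩
  · rw [← MulOpposite.op_mul, hg.idem]
  · simp only [← MulOpposite.op_mul, ← mul_assoc, hg.braid]
  · exact congrArg MulOpposite.op (hg.comm a b c h1 h2).symm

theorem wordProd_op {α M : Type*} [Monoid M] (g : α → M) (w : List α) :
    wordProd (fun a => MulOpposite.op (g a)) w = MulOpposite.op (wordProd g w.reverse) := by
  induction w with
  | nil => simp
  | cons a w ih => simp [ih]

end HeckeOperators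

section Insertion
variable {α : Type*} [LinearOrder α] {β : Type*} [DecidableEq β]

theorem wordProd_insertPairs {M : Type*} [Monoid M] {g : α → M} (hg : IsHeckeFamily g)
    (w : List (β × α)) {S : List (List α) × (ℕ → ℕ → Finset β)} (hS : IsIncreasing S.1) :
    wordProd g (readingWord (insertPairs S w).1) =
      wordProd g (readingWord S.1) * wordProd g (w.map Prod.snd) := by
  induction w generalizing S with
  | nil => simp [insertPairs]
  | cons p w ih =>
    have h1 := isIncreasing_insertBelow hS (admissible_nil S.1 p.2)
    have h2 := wordProd_insertBelow hg hS (admissible_nil S.1 p.2)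
    simp only [wordProd_nil, mul_one] at h2
    have h3 := ih (S := insertStep p.1 S p.2) h1.1
    rw [List.map_cons, wordProd_cons, ← mul_assoc, h2]
    exact h3

/-- Transposing an increasing tableau reverses the element represented by its reading word: if the
reading word represents a word `w`, that of the transpose represents the reverse of `w`. -/
theorem wordProd_readingWord_transposeRows {M : Type*} [Monoid M] {g : α → M}
    {T : List (List α)} (hT : IsIncreasing T) (hg : IsHeckeFamily g) :
    wordProd g (readingWord (transposeRows T)) = wordProd g (readingWord T).reverse := by
  have h := wordProd_columns hg.op hT le_rfl
  rw [← reverse_readingWord_transposeRows, wordProd_op, wordProd_op, List.reverse_reverse] at h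
  exact MulOpposite.op_injective h

end Insertion

/-! ### Double Hecke insertion -/

section Primed
variable {m : ℕ}

/-- The labels of the left half are the primed letters. -/
def IsPrimed (x : PrimedLetter m) : Prop := ∃ i, primed i = x

theorem primed_le_primed {i j : Fin (m + 1)} : primed i ≤ primed j ↔ i ≤ j :=
  Sum.Lex.inl_le_inl_iff

theorem primed_injective : Function.Injective (primed (m := m)) := fun _ _ h =>
  le_antisymm (primed_le_primed.1 h.le) (primed_le_primed.1 h.ge)

theorem unprimed_strictMono : StrictMono (unprimed (m := m)) := fun _ _ h =>
  Sum.Lex.inr_lt_inr_iff.2 h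

theorem not_isPrimed_iff {x : PrimedLetter m} : ¬ IsPrimed x ↔ ∃ i, unprimed i = x := by
  constructor
  · intro h
    match x with
    | .inl i => exact absurd ⟨i, rfl⟩ h
    | .inr i => exact ⟨i, rfl⟩
  · rintro ⟨i, rfl⟩ ⟨j, hj⟩
    exact (Sum.Lex.inl_lt_inr j i).ne hj

theorem IsPrimed.lt {x y : PrimedLetter m} (hx : IsPrimed x) (hy : ¬ IsPrimed y) : x < y := by
  obtain ⟨i, rfl⟩ := hx
  obtain ⟨j, rfl⟩ := not_isPrimed_iff.1 hy
  exact Sum.Lex.inl_lt_inr i j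

end Primed

section Double
variable {n m : ℕ}

/-- Transpose both tableaux of a pair and prime the entries of the recording tableau. -/
def transposePrimed {α : Type*} (S : List (List α) × (ℕ → ℕ → Finset (Fin (m + 1)))) :
    List (List α) × (ℕ → ℕ → Finset (PrimedLetter m)) :=
  (transposeRows S.1, fun i j => (S.2 j i).image primed)

theorem mem_transposePrimed {α : Type*} {S : List (List α) × (ℕ → ℕ → Finset (Fin (m + 1)))}
    {i j : ℕ} {k : Fin (m + 1)} : primed k ∈ (transposePrimed S).2 i j ↔ k ∈ S.2 j i := by
  simp [transposePrimed, primed_injective.eq_iff]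

theorem isPrimed_of_mem_transposePrimed {α : Type*}
    {S : List (List α) × (ℕ → ℕ → Finset (Fin (m + 1)))} {i j : ℕ} {x : PrimedLetter m}
    (hx : x ∈ (transposePrimed S).2 i j) : IsPrimed x := by
  obtain ⟨k, -, rfl⟩ := Finset.mem_image.1 hx
  exact ⟨k, rfl⟩

variable {α : Type*} [LinearOrder α]

theorem isStart_transposePrimed {S : List (List α) × (ℕ → ℕ → Finset (Fin (m + 1)))}
    (hS : IsRecordingPair S) : IsStart IsPrimed (transposePrimed S) := by
  refine ⟨⟨isIncreasing_transposeRows hS.increasing, fun i j => ?_, fun i j x hx y hy => ?_,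
    fun i j x hx y hy => ?_⟩, fun i j x hx => isPrimed_of_mem_transposePrimed hx⟩
  · refine (Finset.image_nonempty).trans ((hS.nonempty_iff j i).trans ?_)
    exact (lt_rowLength_transposeRows hS.increasing j i).symm
  all_goals
    obtain ⟨a, rfl⟩ := isPrimed_of_mem_transposePrimed hx
    obtain ⟨b, rfl⟩ := isPrimed_of_mem_transposePrimed hy
    rw [mem_transposePrimed] at hx hy
    rw [primed_le_primed]
  · exact hS.col_le j i a hx b hy
  · exact hS.row_le j i a hx b hy

theorem exists_transposePrimed {S : List (List α) × (ℕ → ℕ → Finset (PrimedLetter m))}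
    (hS : IsStart IsPrimed S) : ∃ S', IsRecordingPair S' ∧ transposePrimed S' = S := by
  classical
  set S' : List (List α) × (ℕ → ℕ → Finset (Fin (m + 1))) :=
    (transposeRows S.1, fun i j => {k | primed k ∈ S.2 j i}) with hS'
  have hmem : ∀ k i j, k ∈ S'.2 i j ↔ primed k ∈ S.2 j i := by simp [hS']
  refine ⟨S', ⟨isIncreasing_transposeRows hS.increasing, fun i j => ?_, fun i j a ha b hb => ?_,
    fun i j a ha b hb => ?_⟩, Prod.ext (transposeRows_transposeRows hS.increasing) ?_⟩
  · rw [lt_rowLength_transposeRows hS.increasing, ← hS.nonempty_iff]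
    constructor
    · rintro ⟨k, hk⟩
      exact ⟨_, (hmem _ _ _).1 hk⟩
    · rintro ⟨x, hx⟩
      obtain ⟨k, rfl⟩ := hS.old _ _ x hx
      exact ⟨k, (hmem _ _ _).2 hx⟩
  · exact primed_le_primed.1 (hS.col_le j i _ ((hmem _ _ _).1 ha) _ ((hmem _ _ _).1 hb))
  · exact primed_le_primed.1 (hS.row_le j i _ ((hmem _ _ _).1 ha) _ ((hmem _ _ _).1 hb))
  · funext i j
    ext x
    constructor
    · intro hx
      obtain ⟨k, rfl⟩ := isPrimed_of_mem_transposePrimed hx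
      rwa [mem_transposePrimed, hmem] at hx
    · intro hx
      obtain ⟨k, rfl⟩ := hS.old _ _ x hx
      rwa [mem_transposePrimed, hmem]

theorem transposePrimed_injective {S S' : List (List α) × (ℕ → ℕ → Finset (Fin (m + 1)))}
    (hS : IsRecordingPair S) (hS' : IsRecordingPair S')
    (h : transposePrimed S = transposePrimed S') : S = S' := by
  refine Prod.ext ?_ ?_
  · rw [← transposeRows_transposeRows hS.increasing, ← transposeRows_transposeRows hS'.increasing]
    exact congrArg (fun S => transposeRows S.1) h
  · funext i j
    ext k
    rw [← mem_transposePrimed, h, mem_transposePrimed]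

theorem isStart_empty : IsStart (fun _ => False)
    (([], fun _ _ => ∅) : List (List α) × (ℕ → ℕ → Finset (Fin (m + 1)))) := by
  refine ⟨⟨trivial, ?_, ?_, ?_⟩, ?_⟩ <;> simp

theorem IsStart.eq_empty {S : List (List α) × (ℕ → ℕ → Finset (Fin (m + 1)))}
    (hS : IsStart (fun _ => False) S) : S = ([], fun _ _ => ∅) := by
  have hQ : ∀ i j, S.2 i j = ∅ := fun i j => Finset.eq_empty_of_forall_notMem fun x hx =>
    hS.old i j x hx
  refine Prod.ext ?_ (funext fun i => funext fun j => hQ i j)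
  have h := hS.nonempty_iff 0 0
  have hT := hS.increasing
  match hS1 : S.1 with
  | [] => rfl
  | Y :: T =>
    rw [hS1] at h hT
    rw [hQ] at h
    exact absurd hT.1 (by simpa using h)

/-- The factors that are inserted for the left half, from left to right. -/
def leftFactors (f : DoubleFactorization n m) (i : Fin (m + 1)) : List (Fin n) :=
  (f.left i.rev).reverse

/-- The biword that is inserted for the left half. -/
def leftBiword (f : DoubleFactorization n m) : List (Fin (m + 1) × Fin n) :=
  biword id (leftFactors f)

/-- The biword that is inserted for the right half. -/
def rightBiword (f : DoubleFactorization n m) : List (PrimedLetter m × Fin n) :=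
  biword unprimed f.right

theorem leftInsertion_eq (f : DoubleFactorization n m) :
    leftInsertion f = insertPairs ([], fun _ _ => ∅) (leftBiword f) :=
  insertFactors_eq _ _ _

theorem doubleInsertion_eq (f : DoubleFactorization n m) :
    doubleInsertion f = insertPairs (transposePrimed (leftInsertion f)) (rightBiword f) :=
  insertFactors_eq _ _ _

theorem reverse_flatten_leftFactors (f : DoubleFactorization n m) :
    (List.ofFn (leftFactors f)).flatten.reverse = (List.ofFn f.left).flatten := by
  rw [List.reverse_flatten]
  congr 1
  refine List.ext_getElem (by simp) fun i h1 h2 => ?_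
  simp only [List.length_ofFn] at h2
  simp only [List.getElem_reverse, List.getElem_map, List.getElem_ofFn, leftFactors,
    List.reverse_reverse, List.length_map, List.length_ofFn]
  congr 1
  ext
  simp [Fin.val_rev]
  omega

/-- The monotonicity conditions on the factors of a double Hecke factorization. -/
def IsMonotone (f : DoubleFactorization n m) : Prop :=
  (∀ i, (f.left i).Pairwise (· < ·)) ∧ ∀ i, (f.right i).Pairwise (· > ·)

theorem isMonotone_iff {f : DoubleFactorization n m} : IsMonotone f ↔
    (∀ i, (leftFactors f i).Pairwise (· > ·)) ∧ ∀ i, (f.right i).Pairwise (· > ·) := by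
  refine and_congr_left fun _ => ?_
  simp only [leftFactors, List.pairwise_reverse]
  exact ⟨fun h i => h _, fun h i => by simpa using h i.rev⟩

theorem IsMonotone.left {f : DoubleFactorization n m} (hf : IsMonotone f) :
    IsBiword (fun _ => False) (leftBiword f) :=
  isBiword_biword strictMono_id (fun _ => id) (isMonotone_iff.1 hf).1

theorem IsMonotone.right {f : DoubleFactorization n m} (hf : IsMonotone f) :
    IsBiword IsPrimed (rightBiword f) :=
  isBiword_biword unprimed_strictMono (fun i => not_isPrimed_iff.2 ⟨i, rfl⟩) hf.2

theorem IsMonotone.leftSpec {f : DoubleFactorization n m} (hf : IsMonotone f) :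
    InsertionSpec (fun _ => False) ([], fun _ _ => ∅) (leftBiword f) (leftInsertion f) := by
  rw [leftInsertion_eq]
  exact insertionSpec_insertPairs (fun _ _ h => h.elim) isStart_empty _ hf.left

theorem IsMonotone.isStart {f : DoubleFactorization n m} (hf : IsMonotone f) :
    IsStart IsPrimed (transposePrimed (leftInsertion f)) :=
  isStart_transposePrimed hf.leftSpec.toIsRecordingPair

theorem IsMonotone.rightSpec {f : DoubleFactorization n m} (hf : IsMonotone f) :
    InsertionSpec IsPrimed (transposePrimed (leftInsertion f)) (rightBiword f)
      (doubleInsertion f) := by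
  rw [doubleInsertion_eq]
  exact insertionSpec_insertPairs (fun _ _ => IsPrimed.lt) hf.isStart _ hf.right

/-- Double Hecke insertion preserves the permutation represented by the word. -/
theorem IsMonotone.heckeProduct_eq {f : DoubleFactorization n m} (hf : IsMonotone f) :
    heckeProduct (readingWord (doubleInsertion f).1) = heckeProduct f.word := by
  have hg := isHeckeFamily_heckeOperator (n := n)
  have hleft : wordProd heckeOperator (readingWord (leftInsertion f).1).reverse =
      wordProd heckeOperator (List.ofFn f.left).flatten := by
    have h := wordProd_insertPairs hg.op (leftBiword f)
      (S := ([], fun _ _ => (∅ : Finset (Fin (m + 1))))) trivial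
    rw [← leftInsertion_eq, leftBiword, map_snd_biword, wordProd_op, wordProd_op, wordProd_op,
      reverse_flatten_leftFactors] at h
    exact MulOpposite.op_injective (by simpa [readingWord] using h)
  have h : wordProd heckeOperator (readingWord (doubleInsertion f).1) =
      wordProd heckeOperator f.word := by
    rw [doubleInsertion_eq, wordProd_insertPairs hg _ hf.isStart.increasing, rightBiword,
      map_snd_biword, DoubleFactorization.word, wordProd_append, ← hleft,
      ← wordProd_readingWord_transposeRows hf.leftSpec.increasing hg]
    rfl
  have := congrFun h (1 : Equiv.Perm (Fin (n + 1)))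
  rwa [wordProd_heckeOperator_apply, wordProd_heckeOperator_apply] at this

theorem IsMonotone.isPrimedSetValued {f : DoubleFactorization n m} (hf : IsMonotone f)
    {μ : YoungDiagram} (hμ : HasShape (doubleInsertion f).1 μ) :
    IsPrimedSetValued μ (doubleInsertion f).2 := by
  have hr := hf.rightSpec
  refine ⟨fun i j => ?_, hr.row_le, hr.col_le, fun k i j j' => ?_, fun k i i' j h h' => ?_⟩
  · rw [hr.nonempty_iff, hμ.mem_iff]
  · exact hr.rowUnique _ (not_isPrimed_iff.2 ⟨k, rfl⟩) i j j'
  · rw [hr.mem_old _ ⟨k, rfl⟩, mem_transposePrimed] at h h'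
    exact hf.leftSpec.rowUnique k id j i i' h h'

theorem doubleInsertion_injOn :
    Set.InjOn (doubleInsertion (n := n) (m := m)) {f | IsMonotone f} := by
  intro f hf f' hf' h
  rw [doubleInsertion_eq, doubleInsertion_eq] at h
  obtain ⟨h1, h2⟩ := insertPairs_injective (fun _ _ => IsPrimed.lt) hf.isStart hf'.isStart hf.right
    hf'.right h
  have h3 := transposePrimed_injective hf.leftSpec.toIsRecordingPair
    hf'.leftSpec.toIsRecordingPair h1
  rw [leftInsertion_eq, leftInsertion_eq] at h3
  have h4 := (insertPairs_injective (fun _ _ h => h.elim) isStart_empty isStart_empty hf.left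
    hf'.left h3).2
  have h5 := biword_injective unprimed_strictMono.injective hf.2 hf'.2 h2
  have h6 := biword_injective Function.injective_id (isMonotone_iff.1 hf).1
    (isMonotone_iff.1 hf').1 h4
  refine DoubleFactorization.ext (funext fun i => ?_) h5
  have := congrFun h6 i.rev
  simpa [leftFactors] using this

theorem exists_doubleInsertion {μ : YoungDiagram} {P : List (List (Fin n))}
    {Q : ℕ → ℕ → Finset (PrimedLetter m)} (hP : IsIncreasing P) (hμ : HasShape P μ)
    (hQ : IsPrimedSetValued μ Q) : ∃ f, IsMonotone f ∧ doubleInsertion f = (P, Q) := by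
  have hS : IsRecordingPair (P, Q) :=
    ⟨hP, fun i j => by rw [hQ.nonempty_iff, hμ.mem_iff], hQ.row_le, hQ.col_le⟩
  have hrow : RowUnique IsPrimed Q := by
    intro x hx
    obtain ⟨k, rfl⟩ := not_isPrimed_iff.1 hx
    exact hQ.unprimed_row k
  have : Finite (PrimedLetter m) := inferInstanceAs (Finite (Fin (m + 1) ⊕ Fin (m + 1)))
  obtain ⟨S₀, w, hS₀, hw, hins⟩ := exists_insertPairs (fun _ _ => IsPrimed.lt) hS hrow
  obtain ⟨S₁, hS₁, rfl⟩ := exists_transposePrimed hS₀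
  have hspec := insertionSpec_insertPairs (fun _ _ => IsPrimed.lt) hS₀ w hw
  rw [hins] at hspec
  have hrow₁ : RowUnique (fun _ => False) S₁.2 := by
    intro k _ i j j' h h'
    rw [← mem_transposePrimed, ← hspec.mem_old _ ⟨k, rfl⟩] at h h'
    exact hQ.primed_col k j j' i h h'
  obtain ⟨S₂, v, hS₂, hv, hins₁⟩ := exists_insertPairs (fun _ _ h => h.elim) hS₁ hrow₁
  obtain rfl := hS₂.eq_empty
  obtain ⟨fr, hfr, rfl⟩ := exists_biword unprimed_strictMono (fun _ => not_isPrimed_iff) hw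
  obtain ⟨fl, hfl, rfl⟩ := exists_biword (label := id) strictMono_id (fun x => by simp) hv
  have hleft : leftFactors ⟨fun i => (fl i.rev).reverse, fr⟩ = fl := by
    funext i
    simp [leftFactors]
  refine ⟨⟨fun i => (fl i.rev).reverse, fr⟩, isMonotone_iff.2 ⟨by rwa [hleft], hfr⟩, ?_⟩
  rw [doubleInsertion_eq, leftInsertion_eq, leftBiword, hleft, hins₁]
  exact hins

theorem IsMonotone.xWeight_eq {f : DoubleFactorization n m} (hf : IsMonotone f) (i : Fin (m + 1)) :
    tableauXWeight (doubleInsertion f).2 i = f.xWeight i := by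
  rw [tableauXWeight, hf.rightSpec.ncard _ (not_isPrimed_iff.2 ⟨i, rfl⟩), rightBiword,
    count_biword unprimed_strictMono.injective]
  rfl

theorem IsMonotone.yWeight_eq {f : DoubleFactorization n m} (hf : IsMonotone f) (i : Fin (m + 1)) :
    tableauYWeight (doubleInsertion f).2 i = f.yWeight i := by
  have hset : {c : ℕ × ℕ | primed i ∈ (doubleInsertion f).2 c.1 c.2} =
      Prod.swap '' {c : ℕ × ℕ | i ∈ (leftInsertion f).2 c.1 c.2} := by
    rw [Set.image_swap_eq_preimage_swap]
    ext c
    exact (hf.rightSpec.mem_old _ ⟨i, rfl⟩ _ _).trans mem_transposePrimed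
  rw [tableauYWeight, hset, Set.ncard_image_of_injective _ Prod.swap_injective,
    hf.leftSpec.ncard i id, leftBiword]
  have := count_biword Function.injective_id (leftFactors f) i
  rw [id] at this
  rw [this]
  simp [leftFactors, DoubleFactorization.yWeight]

end Double

end DoubleHecke

theorem mainTheorem3 (n m : ℕ) (ω : Equiv.Perm (Fin (n + 1))) :
    Set.BijOn (DoubleHecke.doubleInsertion (n := n) (m := m))
      {f | f.IsDoubleHecke ω}
      {PQ | ∃ μ : YoungDiagram,
        DoubleHecke.IsHeckeTableau ω μ PQ.1 ∧ DoubleHecke.IsPrimedSetValued μ PQ.2} ∧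
    ∀ f : DoubleHecke.DoubleFactorization n m, f.IsDoubleHecke ω →
      ∀ i : Fin (m + 1),
        DoubleHecke.tableauXWeight (DoubleHecke.doubleInsertion f).2 i = f.xWeight i ∧
        DoubleHecke.tableauYWeight (DoubleHecke.doubleInsertion f).2 i = f.yWeight i := by
  have hmono : ∀ {f : DoubleHecke.DoubleFactorization n m}, f.IsDoubleHecke ω →
      DoubleHecke.IsMonotone f := fun hf => ⟨hf.left_increasing, hf.right_decreasing⟩
  refine ⟨⟨fun f hf => ?_, fun f hf f' hf' h => ?_, ?_⟩, fun f hf i => ?_⟩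
  · obtain ⟨μ, hμ⟩ := DoubleHecke.exists_hasShape (hmono hf).rightSpec.increasing
    exact ⟨μ, DoubleHecke.isHeckeTableau_iff.2 ⟨hμ, (hmono hf).rightSpec.increasing,
      (hmono hf).heckeProduct_eq.trans hf.isHeckeWord⟩, (hmono hf).isPrimedSetValued hμ⟩
  · exact DoubleHecke.doubleInsertion_injOn (hmono hf) (hmono hf') h
  · rintro ⟨P, Q⟩ ⟨μ, hP, hQ⟩
    obtain ⟨hμ, hinc, hword⟩ := DoubleHecke.isHeckeTableau_iff.1 hP
    obtain ⟨f, hf, hfPQ⟩ := DoubleHecke.exists_doubleInsertion hinc hμ hQ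
    refine ⟨f, ⟨hf.1, hf.2, ?_⟩, hfPQ⟩
    have := hf.heckeProduct_eq
    rw [hfPQ] at this
    exact this.symm.trans hword
  · exact ⟨(hmono hf).xWeight_eq i, (hmono hf).yWeight_eq i⟩
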